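/- Let $k$ be an algebraically closed field of characteristic $0$ and let $X=X_\Sigma$ be the toric variety over $k$ of a fan $\Sigma$ in $N_{\mathbb R}$, where $M$ is the character lattice, $N=\operatorname{Hom}(M,\mathbb Z)$, and $\langle\cdot,\cdot\rangle$ is the pairing. Let $K$ be the function field of $X$. For a ray $\rho\in\Sigma(1)$, which we identify with its primitive generator in $N$, let $D_\rho$ be the corresponding torus invariant prime divisor, and let $\operatorname{Div}_T(X)=\mathbb Z^{\Sigma(1)}$ be the lattice of torus invariant divisors. For a prime divisor $P$ and $f\in K$ let $f(P)\in\kappa(P)\cup\{\infty\}$ be the value of $f$ at the generic point of $P$ (with $\kappa(P)$ the residue field there), and put $\operatorname{ord}_P(0)=\infty$. A pre-Weil decoration of a finite-dimensional $K$-vector space $\mathcal V$ is a map $\mathcal W\colon\mathcal V\to\operatorname{Div}(X)\cup\{\infty\}$ such that $\mathcal W(v)=\infty$ if and only if $v=0$, $\mathcal W(fv)=\operatorname{div}(f)+\mathcal W(v)$ for $f\in K$, and $\mathcal W(v+v')\ge\mathcal W(v)\wedge\mathcal W(v')$ (coefficientwise minimum). Its associated sheaf is $\mathcal O_X(\mathcal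 W)(U)=\{v\in\mathcal V : \mathcal W(v)|_U\ge 0\}$ for non-empty open $U\subseteq X$. It is called a Weil decoration if it is coherent, i.e. if $\mathcal O_X(\mathcal W)$ is a coherent sheaf. Theorem. (i) Let $h$ be an assignment which associates with every ray $\rho\in\Sigma(1)$ a unit $h(\rho)\in\kappa(D_\rho)^*$. Then the assignment $\mathcal W_h$ on $K^2$ with $\mathcal W_h(0,0)=\infty$ and, for every prime divisor $P$ of $X$, with coefficient $$\mathcal W_h(f,g)_P=\begin{cases}\min\{\operatorname{ord}_P(f),\operatorname{ord}_P(g)\}+1&\text{if }P=D_\rho\text{ for some }\rho\in\Sigma(1)\text{ and }(f/g)(D_\rho)=h(\rho),\\ \min\{\operatorname{ord}_P(f),\operatorname{ord}_P(g)\}&\text{otherwise,}\end{cases}$$ is a Weil decoration, and its associated sheaf $\mathcal O_X(\mathcal W_h)$ is a reflexive sheaf of rank two. (ii) Let $u\colon\operatorname{Div}_T(X)\to M$ be a $\mathbb Z$-linear map such that $u_\rho:=u(D_\rho)$ satisfies $\langle u_\rho,\rho\rangle=0$ for every $\rho\in\Sigma(1)$. Then the assignment $\mathcal W_u$ on $K^2$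 with $\mathcal W_u(0,0)=\infty$ and, for every prime divisor $P$ of $X$, with coefficient $$\mathcal W_u(f,g)_P=\begin{cases}\min\{\operatorname{ord}_P(f),\operatorname{ord}_P(g)\}+1&\text{if }P=D_\rho\text{ for some }\rho\in\Sigma(1)\text{ and }(f/g)(D_\rho)=x^{u_\rho}(D_\rho),\\ \min\{\operatorname{ord}_P(f),\operatorname{ord}_P(g)\}&\text{otherwise,}\end{cases}$$ is a Weil decoration, and its associated sheaf $\mathcal{HM}_X(u):=\mathcal O_X(\mathcal W_u)$ is a reflexive sheaf of rank two. -/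

import Mathlib

open AlgebraicGeometry CategoryTheory Opposite TopologicalSpace

universe u

namespace WeilDeco

noncomputable section

section Dual
variable {X : Scheme.{u}}

instance presheafModule (P : X.PresheafOfModules) (U : X.Opensᵒᵖ) :
    Module (X.presheaf.obj U) (P.obj U) := (P.obj U).isModule

/-- A section over `U` of the dual `ℋom(P, 𝒪_X)` of a presheaf of modules: a morphism
`P|_U → 𝒪_X|_U`, that is, linear maps `P(V) → 𝒪_X(V)` for all open `V ⊆ U` that commute with
restriction. -/
@[ext]
structure DualSection (P : X.PresheafOfModules) (U : X.Opens) : Type u where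
  app : ∀ V : X.Opens, V ≤ U → (P.obj (op V) →ₗ[X.presheaf.obj (op V)] X.presheaf.obj (op V))
  compat : ∀ (V W : X.Opens) (hV : V ≤ U) (h : W ≤ V) (s : P.obj (op V)),
    X.presheaf.map (homOfLE h).op (app V hV s) =
      app W (h.trans hV) (P.restrictₛₗ (homOfLE h).op s)

variable {P : X.PresheafOfModules} {U V : X.Opens}
namespace DualSection

instance : Zero (DualSection P U) := ⟨⟨fun _ _ => 0, fun _ _ _ _ _ => map_zero _⟩⟩
instance : Add (DualSection P U) :=
  ⟨fun φ ψ => ⟨fun V h => φ.app V h + ψ.app V h, fun V W hV h s =>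
    (map_add _ _ _).trans (congrArg₂ (· + ·) (φ.compat V W hV h s) (ψ.compat V W hV h s))⟩⟩
instance : Neg (DualSection P U) :=
  ⟨fun φ => ⟨fun V h => - φ.app V h, fun V W hV h s =>
    (map_neg _ _).trans (congrArg (- ·) (φ.compat V W hV h s))⟩⟩
instance : SMul Γ(X, U) (DualSection P U) :=
  ⟨fun a φ => ⟨fun V h => X.presheaf.map (homOfLE h).op a • φ.app V h, by
    intro V W hV h s
    simp only [LinearMap.smul_apply, smul_eq_mul, map_mul, φ.compat V W hV h s]
    congr 1
    rw [← ConcreteCategory.comp_apply, ← Functor.map_comp]; rfl⟩⟩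

@[simp] lemma zero_app (h : V ≤ U) : (0 : DualSection P U).app V h = 0 := rfl
@[simp] lemma add_app (φ ψ : DualSection P U) (h : V ≤ U) :
    (φ + ψ).app V h = φ.app V h + ψ.app V h := rfl
@[simp] lemma neg_app (φ : DualSection P U) (h : V ≤ U) : (-φ).app V h = -φ.app V h := rfl
@[simp] lemma smul_app (a : Γ(X, U)) (φ : DualSection P U) (h : V ≤ U) :
    (a • φ).app V h = X.presheaf.map (homOfLE h).op a • φ.app V h := rfl

instance : AddCommGroup (DualSection P U) where
  add_assoc φ ψ χ := by ext; simp [add_assoc]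
  zero_add φ := by ext; simp
  add_zero φ := by ext; simp
  add_comm φ ψ := by ext; simp [add_comm]
  neg_add_cancel φ := by ext; simp
  nsmul := nsmulRec
  zsmul := zsmulRec

instance : Module Γ(X, U) (DualSection P U) where
  one_smul φ := by ext; simp
  mul_smul a b φ := by ext; simp [mul_assoc]
  smul_zero a := by ext; simp
  smul_add a φ ψ := by ext; simp
  add_smul a b φ := by ext; simp [add_mul]
  zero_smul φ := by ext; simp

/-- Restriction of sections of the dual. -/
def res (h : V ≤ U) : DualSection P U →+ DualSection P V where
  toFun φ := ⟨fun W hW => φ.app W (hW.trans h), fun A B _ hB s => φ.compat A B _ hB s⟩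
  map_zero' := rfl
  map_add' _ _ := rfl

end DualSection

variable (P) in
/-- The dual as a presheaf of abelian groups. -/
def dualAb : X.Opensᵒᵖ ⥤ Ab.{u} where
  obj U := AddCommGrpCat.of (DualSection P U.unop)
  map f := AddCommGrpCat.ofHom (DualSection.res (leOfHom f.unop))

instance (U : X.Opensᵒᵖ) : Module (X.ringCatSheaf.obj.obj U) ((dualAb P).obj U) :=
  inferInstanceAs (Module Γ(X, U.unop) (DualSection P U.unop))

lemma DualSection.res_smul (h : V ≤ U) (a : Γ(X, U)) (φ : DualSection P U) :
    DualSection.res h (a • φ) = X.presheaf.map (homOfLE h).op a • DualSection.res h φ := by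
  refine DualSection.ext ?_
  funext W hW
  change X.presheaf.map (homOfLE _).op a • φ.app W _ =
    X.presheaf.map (homOfLE hW).op (X.presheaf.map (homOfLE h).op a) • φ.app W _
  rw [← ConcreteCategory.comp_apply, ← Functor.map_comp]
  rfl

variable (P) in
/-- The dual `P^∨ = ℋom(P, 𝒪_X)` as a presheaf of `𝒪_X`-modules. -/
def dual : X.PresheafOfModules :=
  PresheafOfModules.ofPresheaf (dualAb P)
    (fun _ _ f a φ => DualSection.res_smul (leOfHom f.unop) a φ)

/-- The natural map `P(U) → P^∨^∨(U)` into the double dual, `s ↦ (φ ↦ φ(s))`. -/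
def evalDual (U : X.Opens) (s : P.obj (op U)) : DualSection (dual P) U where
  app V hV :=
    { toFun := fun φ : DualSection P V => φ.app V le_rfl (P.restrictₛₗ (homOfLE hV).op s)
      map_add' := fun φ ψ => rfl
      map_smul' := fun (a : Γ(X, V)) (φ : DualSection P V) => by
        change (X.presheaf.map (𝟙 _) a) * _ = a * _
        rw [CategoryTheory.Functor.map_id]; rfl }
  compat := by
    intro V W hV h φ
    refine (DualSection.compat (show DualSection P V from φ) V W le_rfl h _).trans ?_
    refine congrArg (DualSection.app (show DualSection P V from φ) W h) ?_
    exact (P.map_comp_apply (homOfLE hV).op (homOfLE h).op s).symm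

/-- The stalk of a presheaf of modules is a module over the stalk of the presheaf of rings. -/
@[reducible] def stalkModule {Y : TopCat.{u}} (R : Y.Presheaf CommRingCat.{u})
    (M : PresheafOfModules.{u} (R ⋙ forget₂ CommRingCat RingCat)) (x : Y) :
    Module (R.stalk x) ↑(TopCat.Presheaf.stalk (C := Ab.{u}) M.presheaf x) := inferInstance

instance (M : X.Modules) (x : X) : Module (X.presheaf.stalk x)
    ↑(TopCat.Presheaf.stalk (C := Ab.{u}) M.presheaf x) :=
  stalkModule X.presheaf M.val x

/-- A sheaf of modules `F` is coherent if `X` is covered by affine opens `U` on each of which `F` is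
the sheaf associated with a finitely generated `Γ(X, U)`-module. -/
def IsCoherent (F : X.Modules) : Prop :=
  ∀ x : X, ∃ (U : X.Opens) (hU : IsAffineOpen U), x ∈ U ∧ ∃ N : ModuleCat.{u} Γ(X, U),
    Module.Finite Γ(X, U) N ∧ Nonempty (F.restrict hU.fromSpec ≅ tilde N)

/-- A reflexive sheaf: a coherent sheaf whose natural map into the double dual is an
isomorphism. -/
def IsReflexive (F : X.Modules) : Prop :=
  IsCoherent F ∧ ∀ U : X.Opens, Function.Bijective (evalDual (P := F.val) U)

/-- The rank of a sheaf of modules on an integral scheme: the dimension of its generic stalk over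
the function field. -/
def rank [IsIntegral X] (F : X.Modules) : ℕ :=
  Module.finrank (X.presheaf.stalk (genericPoint X))
    ↑(TopCat.Presheaf.stalk (C := Ab.{u}) F.presheaf (genericPoint X))

end Dual

section Decoration
variable (X : Scheme.{u})

/-- A prime divisor of `X`, given by its generic point: a point of codimension one. -/
def PrimeDivisor : Type u := {P : X // Order.coheight P = 1}

/-- The group of Weil divisors. -/
abbrev WeilDivisor : Type u := PrimeDivisor X →₀ ℤ

variable {X}

/-- The coefficient of a Weil divisor at a prime divisor; the formal divisor `∞` has all
coefficients `∞`. -/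
def coeff (D : WithTop (WeilDivisor X)) (P : PrimeDivisor X) : WithTop ℤ := D.map fun E => E P

lemma coeff_inf_le {D E F : WithTop (WeilDivisor X)} (h : D ⊓ E ≤ F) (P : PrimeDivisor X) :
    coeff D P ⊓ coeff E P ≤ coeff F P := by
  cases D with
  | top => cases F with
    | top => exact le_top
    | coe F => cases E with
      | top => simp at h
      | coe E =>
        have h' : E ≤ F := by simpa using h
        exact inf_le_right.trans (WithTop.coe_le_coe.2 (h' P))
  | coe D => cases F with
    | top => exact le_top
    | coe F => cases E with
      | top =>
        have h' : D ≤ F := by simpa using h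
        exact inf_le_left.trans (WithTop.coe_le_coe.2 (h' P))
      | coe E =>
        have h' : D ⊓ E ≤ F := by exact_mod_cast h
        have := h' P
        rw [Finsupp.inf_apply] at this
        change ((D P : ℤ) : WithTop ℤ) ⊓ ((E P : ℤ) : WithTop ℤ) ≤ ((F P : ℤ) : WithTop ℤ)
        exact_mod_cast this

variable [IsIntegral X]

/-- The rational function defined by a regular function on `U`; the point `x` only witnesses that
`U` is non-empty. -/
def germAt {U : X.Opens} (x : U) : Γ(X, U) →+* X.functionField :=
  haveI : Nonempty U := ⟨x⟩
  (X.germToFunctionField U).hom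

lemma germAt_eq {U : X.Opens} (x y : U) : (germAt x : Γ(X, U) →+* X.functionField) = germAt y := rfl

lemma germAt_map {U U' : X.Opens} (h : U' ≤ U) (x : U') (a : Γ(X, U)) :
    germAt x (X.presheaf.map (homOfLE h).op a) = germAt ⟨x.1, h x.2⟩ a :=
  TopCat.Presheaf.germ_res_apply X.presheaf (homOfLE h) _ _ a

open Classical in
/-- The value `f(P)` of a rational function at the generic point of a prime divisor: its residue class
in the residue field of `P` if `f` is regular there, and `∞` otherwise. -/
def value (P : PrimeDivisor X) (f : X.functionField) : WithTop (X.residueField P.1) :=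
  if h : ∃ a : X.presheaf.stalk P.1, algebraMap (X.presheaf.stalk P.1) X.functionField a = f then
    ((X.residue P.1 h.choose : X.residueField P.1) : WithTop (X.residueField P.1))
  else ⊤

variable [IsLocallyNoetherian X]

open Classical in
/-- The order of vanishing `ord_P f`, with `ord_P 0 = ∞`. -/
def ordTop (P : PrimeDivisor X) (f : X.functionField) : WithTop ℤ :=
  if f = 0 then ⊤ else (Scheme.ord f P.1 : ℤ)

lemma ordTop_germ_nonneg (P : PrimeDivisor X) {U : X.Opens} [Nonempty U] (hP : P.1 ∈ U)
    (a : Γ(X, U)) : 0 ≤ ordTop P (X.germToFunctionField U a) := by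
  unfold ordTop
  split_ifs with h
  · exact le_top
  · have ha : a ≠ 0 := by rintro rfl; simp at h
    have h1 := Scheme.ord_le_smul hP ha (1 : X.functionField)
    have h2 : Scheme.ord (1 : X.functionField) P.1 = 0 := by
      have := Scheme.ord_of_isUnit (U := U) (f := 1) isUnit_one hP
      simpa using this
    rw [h2, Algebra.smul_def, mul_one] at h1
    exact_mod_cast h1

variable (X) in
/-- A pre-Weil decoration `W : V → Div(X) ∪ {∞}` of a vector space `V` over the function field:
`W(v) = ∞` if and only if `v = 0`, `W(f v) = div(f) + W(v)` (read off on the coefficients), and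
`W(v) ∧ W(v') ≤ W(v + v')`, where `∧` is the coefficientwise minimum. -/
structure PreWeilDecoration (V : Type u) [AddCommGroup V] [Module X.functionField V] where
  toFun : V → WithTop (WeilDivisor X)
  eq_top_iff : ∀ v, toFun v = ⊤ ↔ v = 0
  smul : ∀ (f : X.functionField) (v : V) (P : PrimeDivisor X),
    coeff (toFun (f • v)) P = ordTop P f + coeff (toFun v) P
  inf_le_add : ∀ v v' : V, toFun v ⊓ toFun v' ≤ toFun (v + v')

namespace PreWeilDecoration
variable {V : Type u} [AddCommGroup V] [Module X.functionField V] (W : PreWeilDecoration X V)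

lemma coeff_zero (P : PrimeDivisor X) : coeff (W.toFun 0) P = ⊤ := by
  rw [(W.eq_top_iff 0).2 rfl]; rfl

/-- The sections over `U` of the sheaf associated with `W`: the `v ∈ V` with `W(v)|_U ≥ 0`, seen as
constant functions on `U` (so that `0` is the only section over the empty set). -/
def sections (U : X.Opens) : AddSubgroup (U → V) where
  carrier := {s | (∀ x y, s x = s y) ∧
    ∀ x, ∀ P : PrimeDivisor X, P.1 ∈ U → 0 ≤ coeff (W.toFun (s x)) P}
  zero_mem' := ⟨fun _ _ => rfl, fun x P _ => by
    rw [Pi.zero_apply, coeff_zero]; exact le_top⟩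
  add_mem' {s t} hs ht := ⟨fun x y => by rw [Pi.add_apply, hs.1 x y, ht.1 x y, Pi.add_apply],
    fun x P hP => (le_inf (hs.2 x P hP) (ht.2 x P hP)).trans
      (coeff_inf_le (W.inf_le_add (s x) (t x)) P)⟩
  neg_mem' {s} hs := ⟨fun x y => by rw [Pi.neg_apply, hs.1 x y, Pi.neg_apply],
    fun x P hP => by
      have : Nonempty U := ⟨x⟩
      have h1 := ordTop_germ_nonneg P hP (-1 : Γ(X, U))
      rw [map_neg, map_one] at h1
      have h2 := W.smul (-1) (s x) P
      rw [neg_smul, one_smul] at h2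
      rw [Pi.neg_apply, h2]
      exact add_nonneg h1 (hs.2 x P hP)⟩

instance (U : X.Opens) : SMul Γ(X, U) (W.sections U) :=
  ⟨fun a s => ⟨fun x => germAt x a • s.1 x,
    fun x y => by
      change germAt x a • s.1 x = germAt x a • s.1 y
      rw [s.2.1 x y],
    fun x P hP => by
      have : Nonempty U := ⟨x⟩
      rw [W.smul]
      exact add_nonneg (ordTop_germ_nonneg P hP a) (s.2.2 x P hP)⟩⟩

instance (U : X.Opens) : Module Γ(X, U) (W.sections U) where
  one_smul s := by ext x; change germAt x 1 • s.1 x = _; simp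
  mul_smul a b s := by
    ext x; change germAt x (a * b) • s.1 x = germAt x a • germAt x b • s.1 x; rw [map_mul, mul_smul]
  smul_zero a := by ext x; exact smul_zero _
  smul_add a s t := by ext x; exact smul_add _ _ _
  add_smul a b s := by
    ext x; change germAt x (a + b) • s.1 x = germAt x a • s.1 x + germAt x b • s.1 x
    rw [map_add, add_smul]
  zero_smul s := by ext x; change germAt x 0 • s.1 x = 0; rw [map_zero, zero_smul]

/-- Restriction of sections. -/
def res {U U' : X.Opens} (h : U' ≤ U) : W.sections U →+ W.sections U' where
  toFun s := ⟨fun x => s.1 ⟨x.1, h x.2⟩, fun _ _ => s.2.1 _ _, fun _ P hP => s.2.2 _ P (h hP)⟩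
  map_zero' := rfl
  map_add' _ _ := rfl

/-- The associated sheaf as a presheaf of abelian groups. -/
def sheafAb : TopCat.Presheaf Ab.{u} X where
  obj U := AddCommGrpCat.of (W.sections U.unop)
  map f := AddCommGrpCat.ofHom (W.res (leOfHom f.unop))

instance (U : X.Opensᵒᵖ) : Module (X.ringCatSheaf.obj.obj U) (W.sheafAb.obj U) :=
  inferInstanceAs (Module Γ(X, U.unop) (W.sections U.unop))

lemma isSheaf_sheafAb : W.sheafAb.IsSheaf := by
  refine (TopCat.Presheaf.isSheaf_iff_isSheafUniqueGluing _).2 fun ι U sf hsf => ?_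
  replace hsf : ∀ i j (x : X) (hi : x ∈ U i) (hj : x ∈ U j),
      (show W.sections (U i) from sf i).1 ⟨x, hi⟩ = (show W.sections (U j) from sf j).1 ⟨x, hj⟩ :=
    fun i j x hi hj => congrFun (congrArg Subtype.val (hsf i j)) ⟨x, hi, hj⟩
  have hex : ∀ x : ↑(iSup U), ∃ i, x.1 ∈ U i := fun x => Opens.mem_iSup.1 x.2
  have key : ∀ i j (x y : X) (hx : x ∈ U i) (hy : y ∈ U j),
      (show W.sections (U i) from sf i).1 ⟨x, hx⟩ =
        (show W.sections (U j) from sf j).1 ⟨y, hy⟩ := by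
    intro i j x y hx hy
    obtain ⟨z, hzi, hzj⟩ := nonempty_preirreducible_inter (U i).isOpen (U j).isOpen
      ⟨x, hx⟩ ⟨y, hy⟩
    rw [(show W.sections (U i) from sf i).2.1 ⟨x, hx⟩ ⟨z, hzi⟩, hsf i j z hzi hzj,
      (show W.sections (U j) from sf j).2.1 ⟨z, hzj⟩ ⟨y, hy⟩]
  choose c hc using hex
  refine ⟨(⟨fun x => (show W.sections (U (c x)) from sf (c x)).1 ⟨x.1, hc x⟩,
    fun x y => key _ _ _ _ _ _, fun x P hP => ?_⟩ : W.sections (iSup U)),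
    fun i => Subtype.ext (funext fun x => key _ _ _ _ _ _), fun t ht => ?_⟩
  · obtain ⟨j, hj⟩ := Opens.mem_iSup.1 hP
    exact ((show W.sections (U j) from sf j).2.2 ⟨P.1, hj⟩ P hj).trans_eq
      (congrArg (fun v => coeff (W.toFun v) P) (key j (c x) P.1 x.1 hj (hc x)))
  · refine Subtype.ext (funext fun x => ?_)
    exact congrFun (congrArg Subtype.val (ht (c x))) ⟨x.1, hc x⟩

/-- The sheaf of `𝒪_X`-modules `𝒪_X(W)` associated with `W`. -/
def sheaf : X.Modules where
  val := PresheafOfModules.ofPresheaf W.sheafAb fun U U' f a s => by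
    refine Subtype.ext (funext fun x => ?_)
    exact congrArg (· • _) (germAt_map (leOfHom f.unop) x a).symm
  isSheaf := W.isSheaf_sheafAb

/-- A Weil decoration is a pre-Weil decoration which is coherent: its associated sheaf is
coherent. -/
def IsWeilDecoration : Prop := IsCoherent W.sheaf

end PreWeilDecoration

end Decoration

section Fan
variable {M : Type u} [AddCommGroup M]

/-- The image of a lattice vector `n ∈ N = Hom(M, ℤ)` in `N_ℝ = Hom(M, ℝ)`. -/
def toReal (n : M →ₗ[ℤ] ℤ) : M →ₗ[ℤ] ℝ := Algebra.linearMap ℤ ℝ ∘ₗ n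

@[simp] lemma toReal_apply (n : M →ₗ[ℤ] ℤ) (m : M) : toReal n m = (n m : ℝ) := rfl

/-- The monoid `σ^∨ ∩ M` of the lattice points `m` with `⟨m, v⟩ ≥ 0` for all `v ∈ σ`. -/
def dualMonoid (σ : PointedCone ℝ (M →ₗ[ℤ] ℝ)) : AddSubmonoid M where
  carrier := {m | ∀ v ∈ σ, 0 ≤ v m}
  zero_mem' := by simp
  add_mem' ha hb v hv := by simpa using add_nonneg (ha v hv) (hb v hv)

lemma mem_dualMonoid {σ : PointedCone ℝ (M →ₗ[ℤ] ℝ)} {m : M} :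
    m ∈ dualMonoid σ ↔ ∀ v ∈ σ, 0 ≤ v m := Iff.rfl

lemma dualMonoid_anti {σ τ : PointedCone ℝ (M →ₗ[ℤ] ℝ)} (h : τ ≤ σ) :
    dualMonoid σ ≤ dualMonoid τ := fun _ hm v hv => hm v (h hv)

/-- `τ` is a face of the rational cone `σ`: `τ = σ ∩ m^⊥` for some `m ∈ σ^∨ ∩ M`. -/
def IsFace (τ σ : PointedCone ℝ (M →ₗ[ℤ] ℝ)) : Prop :=
  ∃ m ∈ dualMonoid σ, ∀ v, v ∈ τ ↔ v ∈ σ ∧ v m = 0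

/-- `σ` is generated by finitely many vectors of the lattice `N = Hom(M, ℤ)`. -/
def IsRationalPolyhedral (σ : PointedCone ℝ (M →ₗ[ℤ] ℝ)) : Prop :=
  ∃ S : Finset (M →ₗ[ℤ] ℤ), σ = PointedCone.hull ℝ (toReal '' (S : Set (M →ₗ[ℤ] ℤ)))

variable (M) in
/-- A fan in `N_ℝ = Hom(M, ℝ)`: a finite non-empty set of strongly convex rational polyhedral cones,
closed under taking faces, such that the intersection of any two of them is a face of each. -/
structure Fan where
  cones : Set (PointedCone ℝ (M →ₗ[ℤ] ℝ))
  finite : cones.Finite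
  zero_mem : ⊥ ∈ cones
  rational : ∀ σ ∈ cones, IsRationalPolyhedral σ
  stronglyConvex : ∀ σ ∈ cones, ∀ v ∈ σ, -v ∈ σ → v = 0
  face_mem : ∀ σ ∈ cones, ∀ τ, IsFace τ σ → τ ∈ cones
  isFace_inf : ∀ σ ∈ cones, ∀ τ ∈ cones, IsFace (σ ⊓ τ) σ

lemma mem_dualMonoid_hull {S : Finset (M →ₗ[ℤ] ℤ)} {m : M} :
    m ∈ dualMonoid (PointedCone.hull ℝ (toReal '' (S : Set (M →ₗ[ℤ] ℤ)))) ↔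
      ∀ n ∈ S, 0 ≤ n m := by
  constructor
  · intro h n hn
    have := h (toReal n) (Submodule.subset_span ⟨n, hn, rfl⟩)
    simpa using this
  · intro h v hv
    induction hv using Submodule.span_induction with
    | mem v hv => obtain ⟨n, hn, rfl⟩ := hv; simpa using h n hn
    | zero => simp
    | add v w _ _ hv hw => simpa using add_nonneg hv hw
    | smul a v _ hv =>
      change 0 ≤ (a : ℝ) * v m
      exact mul_nonneg a.2 hv

lemma dualMonoid_fg [Module.Free ℤ M] [Module.Finite ℤ M] {σ : PointedCone ℝ (M →ₗ[ℤ] ℝ)}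
    (hσ : IsRationalPolyhedral σ) : (dualMonoid σ).FG := by
  classical
  obtain ⟨S, rfl⟩ := hσ
  let b := Module.finBasis ℤ M
  let ι := Fin (Module.finrank ℤ M)
  let pos : (ι ⊕ ι ⊕ S → ℕ) →+ M :=
    { toFun := fun a => ∑ i, (a (.inl i)) • b i
      map_zero' := by simp
      map_add' := by intro x y; simp [add_smul, Finset.sum_add_distrib] }
  let neg : (ι ⊕ ι ⊕ S → ℕ) →+ M :=
    { toFun := fun a => ∑ i, (a (.inr (.inl i))) • b i
      map_zero' := by simp
      map_add' := by intro x y; simp [add_smul, Finset.sum_add_distrib] }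
  let f : (ι ⊕ ι ⊕ S → ℕ) →+ (S → ℤ) :=
    { toFun := fun a n => n.1 (pos a)
      map_zero' := by ext; simp
      map_add' := by intro x y; ext; simp }
  let g : (ι ⊕ ι ⊕ S → ℕ) →+ (S → ℤ) :=
    { toFun := fun a n => n.1 (neg a) + (a (.inr (.inr n)) : ℤ)
      map_zero' := by ext; simp
      map_add' := by intro x y; ext; simp; ring }
  have hfg := (AddSubmonoid.fg_eqLocusM f g).map (pos - neg)
  convert! hfg
  ext m
  rw [mem_dualMonoid_hull, AddSubmonoid.mem_map]
  constructor
  · intro h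
    refine ⟨Sum.elim (fun i => (b.repr m i).toNat) (Sum.elim (fun i => (-b.repr m i).toNat)
      (fun n => (n.1 m).toNat)), ?_, ?_⟩
    all_goals
      have key : pos (Sum.elim (fun i => (b.repr m i).toNat) (Sum.elim
        (fun i => (-b.repr m i).toNat) (fun n => (n.1 m).toNat))) - neg (Sum.elim
        (fun i => (b.repr m i).toNat) (Sum.elim (fun i => (-b.repr m i).toNat)
        (fun n => (n.1 m).toNat))) = m := by
        change ∑ i, ((b.repr m i).toNat) • b i - ∑ i, ((-b.repr m i).toNat) • b i = m
        rw [← Finset.sum_sub_distrib]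
        conv_rhs => rw [← b.sum_repr m]
        refine Finset.sum_congr rfl fun i _ => ?_
        rw [← natCast_zsmul, ← natCast_zsmul, ← sub_smul, Int.toNat_sub_toNat_neg]
    · change f _ = g _
      funext n
      rw [sub_eq_iff_eq_add] at key
      change n.1 (pos _) = n.1 (neg _) + (((n.1 m).toNat : ℕ) : ℤ)
      rw [key, map_add, Int.toNat_of_nonneg (h n.1 n.2), add_comm]
    · exact key
  · rintro ⟨a, ha, rfl⟩ n hn
    have := congrFun (show f a = g a from ha) ⟨n, hn⟩
    change n (pos a) = n (neg a) + (a (.inr (.inr ⟨n, hn⟩)) : ℤ) at this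
    change 0 ≤ n (pos a - neg a)
    rw [map_sub, this]
    simp

section Charts
variable (k : Type u) [Field k]

/-- The coordinate ring `k[σ^∨ ∩ M]`. -/
abbrev CoordRing (σ : PointedCone ℝ (M →ₗ[ℤ] ℝ)) : Type u := AddMonoidAlgebra k (dualMonoid σ)

/-- The monomial `x^m` for `m ∈ σ^∨ ∩ M`. -/
abbrev chi (σ : PointedCone ℝ (M →ₗ[ℤ] ℝ)) (m : dualMonoid σ) : CoordRing k σ :=
  AddMonoidAlgebra.single m 1

variable {k} in
lemma chi_mul {σ : PointedCone ℝ (M →ₗ[ℤ] ℝ)} (m m' : dualMonoid σ) :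
    chi k σ m * chi k σ m' = chi k σ (m + m') := by simp [chi]

/-- The inclusion `k[σ^∨ ∩ M] → k[τ^∨ ∩ M]` for `τ ⊆ σ`. -/
def coordMap {σ τ : PointedCone ℝ (M →ₗ[ℤ] ℝ)} (h : τ ≤ σ) : CoordRing k σ →+* CoordRing k τ :=
  AddMonoidAlgebra.mapDomainRingHom k (AddSubmonoid.inclusion (dualMonoid_anti h))

lemma coordMap_single {σ τ : PointedCone ℝ (M →ₗ[ℤ] ℝ)} (h : τ ≤ σ) (m : dualMonoid σ) (a : k) :
    coordMap k h (AddMonoidAlgebra.single m a) =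
      AddMonoidAlgebra.single (⟨m.1, dualMonoid_anti h m.2⟩ : dualMonoid τ) a := by
  simp [coordMap]; rfl

lemma coordMap_injective {σ τ : PointedCone ℝ (M →ₗ[ℤ] ℝ)} (h : τ ≤ σ) :
    Function.Injective (coordMap k h) :=
  AddMonoidAlgebra.mapDomain_injective
    (fun _ _ hxy => Subtype.ext (congrArg (fun z : dualMonoid τ => (z : M)) hxy))

lemma coordMap_refl (σ : PointedCone ℝ (M →ₗ[ℤ] ℝ)) : coordMap k (le_refl σ) = RingHom.id _ := by
  refine AddMonoidAlgebra.ringHom_ext (fun a => ?_) (fun m => ?_) <;>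
  · rw [coordMap_single]; rfl

lemma coordMap_comp {σ τ υ : PointedCone ℝ (M →ₗ[ℤ] ℝ)} (h : τ ≤ σ) (h' : υ ≤ τ) :
    (coordMap k h').comp (coordMap k h) = coordMap k (h'.trans h) := by
  refine AddMonoidAlgebra.ringHom_ext (fun a => ?_) (fun m => ?_) <;>
  · simp only [RingHom.comp_apply, coordMap_single]

lemma exists_nsmul_add_mem {σ τ : PointedCone ℝ (M →ₗ[ℤ] ℝ)} (hσ : IsRationalPolyhedral σ)
    {m : M} (hm : m ∈ dualMonoid σ) (hτ : ∀ v, v ∈ τ ↔ v ∈ σ ∧ v m = 0)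
    {m' : M} (hm' : m' ∈ dualMonoid τ) : ∃ l₀ : ℕ, ∀ l ≥ l₀, m' + l • m ∈ dualMonoid σ := by
  classical
  obtain ⟨S, rfl⟩ := hσ
  have hmS := mem_dualMonoid_hull.1 hm
  refine ⟨∑ n ∈ S, (n m').natAbs, fun l hl => mem_dualMonoid_hull.2 fun n hn => ?_⟩
  have h1 : (n m').natAbs ≤ l :=
    (Finset.single_le_sum (f := fun n : M →ₗ[ℤ] ℤ => (n m').natAbs) (fun _ _ => Nat.zero_le _)
      hn).trans hl
  rw [map_add, map_nsmul, nsmul_eq_mul]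
  rcases (hmS n hn).eq_or_lt with h0 | h0
  · have hv : toReal n ∈ τ := (hτ _).2 ⟨Submodule.subset_span ⟨n, hn, rfl⟩, by simp [← h0]⟩
    have := hm' _ hv
    simp only [toReal_apply, Int.cast_nonneg_iff] at this
    simp [← h0, this]
  · have : (l : ℤ) * 1 ≤ l * n m := by gcongr; omega
    omega

lemma isLocalization_coordMap {σ τ : PointedCone ℝ (M →ₗ[ℤ] ℝ)} (hσ : IsRationalPolyhedral σ)
    (m : dualMonoid σ) (hτ : ∀ v, v ∈ τ ↔ v ∈ σ ∧ v (m : M) = 0) (h : τ ≤ σ) :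
    letI := (coordMap k h).toAlgebra
    IsLocalization.Away (chi k σ m) (CoordRing k τ) := by
  let := (coordMap k h).toAlgebra
  have hneg : -(m : M) ∈ dualMonoid τ := fun v hv => by simp [((hτ v).1 hv).2]
  have hpow : ∀ l : ℕ, chi k σ m ^ l = chi k σ (l • m) := fun l => by
    simp [chi, AddMonoidAlgebra.single_pow]
  refine (isLocalization_iff _ _).2 ⟨?_, ?_, ?_⟩
  · rintro ⟨_, l, rfl⟩
    change IsUnit (coordMap k h (chi k σ m ^ l))
    rw [map_pow]
    refine IsUnit.pow _ (IsUnit.of_mul_eq_one (chi k τ ⟨_, hneg⟩) ?_)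
    rw [coordMap_single, chi_mul, AddMonoidAlgebra.one_def]
    congr 1
    exact Subtype.ext (add_neg_cancel _)
  · have key : ∀ z : CoordRing k τ, ∃ l₀ : ℕ, ∀ l ≥ l₀, ∃ x, z * coordMap k h (chi k σ (l • m)) =
        coordMap k h x := by
      intro z
      induction z using AddMonoidAlgebra.induction_linear with
      | zero => exact ⟨0, fun l _ => ⟨0, by simp⟩⟩
      | add f g hf hg =>
        obtain ⟨a, ha⟩ := hf
        obtain ⟨b, hb⟩ := hg
        refine ⟨max a b, fun l hl => ?_⟩
        obtain ⟨x, hx⟩ := ha l (le_of_max_le_left hl)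
        obtain ⟨y, hy⟩ := hb l (le_of_max_le_right hl)
        exact ⟨x + y, by rw [add_mul, hx, hy, map_add]⟩
      | single m' a =>
        obtain ⟨l₀, hl₀⟩ := exists_nsmul_add_mem hσ m.2 hτ m'.2
        refine ⟨l₀, fun l hl => ⟨AddMonoidAlgebra.single ⟨_, hl₀ l hl⟩ a, ?_⟩⟩
        rw [coordMap_single, coordMap_single, AddMonoidAlgebra.single_mul_single, mul_one]
        congr 1
    intro z
    obtain ⟨l, hl⟩ := key z
    obtain ⟨x, hx⟩ := hl l le_rfl
    exact ⟨(x, ⟨_, l, rfl⟩), by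
      change z * coordMap k h (chi k σ m ^ l) = _
      rw [hpow]; exact hx⟩
  · intro x y hxy
    exact ⟨1, by rw [coordMap_injective k h hxy]⟩

/-- The affine toric variety `U_σ = Spec k[σ^∨ ∩ M]`. -/
abbrev affineChart (σ : PointedCone ℝ (M →ₗ[ℤ] ℝ)) : Scheme.{u} := Spec (.of (CoordRing k σ))

/-- The map `U_τ → U_σ` for `τ ⊆ σ`; an open immersion if `τ` is a face of `σ`. -/
def chartMap {σ τ : PointedCone ℝ (M →ₗ[ℤ] ℝ)} (h : τ ≤ σ) : affineChart k τ ⟶ affineChart k σ :=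
  Spec.map (CommRingCat.ofHom (coordMap k h))

lemma isOpenImmersion_chartMap {σ τ : PointedCone ℝ (M →ₗ[ℤ] ℝ)} (hσ : IsRationalPolyhedral σ)
    (m : dualMonoid σ) (hτ : ∀ v, v ∈ τ ↔ v ∈ σ ∧ v (m : M) = 0) (h : τ ≤ σ) :
    IsOpenImmersion (chartMap k h) := by
  let := (coordMap k h).toAlgebra
  have := isLocalization_coordMap k hσ m hτ h
  exact IsOpenImmersion.of_isLocalization (chi k σ m)

lemma range_chartMap {σ τ : PointedCone ℝ (M →ₗ[ℤ] ℝ)} (hσ : IsRationalPolyhedral σ)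
    (m : dualMonoid σ) (hτ : ∀ v, v ∈ τ ↔ v ∈ σ ∧ v (m : M) = 0) (h : τ ≤ σ) :
    Set.range (chartMap k h) = (PrimeSpectrum.basicOpen (chi k σ m) : Set (PrimeSpectrum _)) := by
  let := (coordMap k h).toAlgebra
  have := isLocalization_coordMap k hσ m hτ h
  exact PrimeSpectrum.localization_away_comap_range (CoordRing k τ) (chi k σ m)

lemma chartMap_comp {σ τ υ : PointedCone ℝ (M →ₗ[ℤ] ℝ)} (h : τ ≤ σ) (h' : υ ≤ τ) :
    chartMap k h' ≫ chartMap k h = chartMap k (h'.trans h) := by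
  change Spec.map _ ≫ Spec.map _ = Spec.map _
  rw [← Spec.map_comp, ← CommRingCat.ofHom_comp, coordMap_comp]

lemma chartMap_chartMap {σ τ υ : PointedCone ℝ (M →ₗ[ℤ] ℝ)} (h : τ ≤ σ) (h' : υ ≤ τ)
    (z : affineChart k υ) : chartMap k h (chartMap k h' z) = chartMap k (h'.trans h) z := by
  rw [← chartMap_comp k h h', Scheme.Hom.comp_apply]

/-- The gluing diagram of the affine toric varieties `U_σ`, `σ ∈ Δ`. -/
def chartFunctor (Δ : Fan M) : Δ.cones ⥤ Scheme.{u} where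
  obj σ := affineChart k σ.1
  map f := chartMap k (leOfHom f)
  map_id σ := by
    change Spec.map (CommRingCat.ofHom (coordMap k (le_refl σ.1))) = _
    rw [coordMap_refl]
    exact Spec.map_id _
  map_comp f g := (chartMap_comp k (leOfHom g) (leOfHom f)).symm

variable (Δ : Fan M)

instance {σ τ : Δ.cones} (f : τ ⟶ σ) : IsOpenImmersion ((chartFunctor k Δ).map f) := by
  obtain ⟨m, hm, h⟩ := Δ.isFace_inf σ.1 σ.2 τ.1 τ.2
  rw [inf_eq_right.2 (leOfHom f)] at h
  exact isOpenImmersion_chartMap k (Δ.rational _ σ.2) ⟨m, hm⟩ h (leOfHom f)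

lemma Fan.inf_mem (σ τ : Δ.cones) : σ.1 ⊓ τ.1 ∈ Δ.cones :=
  Δ.face_mem _ σ.2 _ (Δ.isFace_inf _ σ.2 _ τ.2)

instance : (chartFunctor k Δ ⋙ Scheme.forget).IsLocallyDirected where
  cond {σ τ υ} f g x y hxy := by
    let l : Δ.cones := ⟨σ.1 ⊓ τ.1, Δ.inf_mem σ τ⟩
    let f' : l ⟶ σ := homOfLE (show σ.1 ⊓ τ.1 ≤ σ.1 from inf_le_left)
    let g' : l ⟶ τ := homOfLE (show σ.1 ⊓ τ.1 ≤ τ.1 from inf_le_right)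
    obtain ⟨m, hm, h⟩ := Δ.isFace_inf υ.1 υ.2 τ.1 τ.2
    rw [inf_eq_right.2 (leOfHom g)] at h
    have hmσ : m ∈ dualMonoid σ.1 := dualMonoid_anti (leOfHom f) hm
    have hxy' : chartMap k (leOfHom f) x = chartMap k (leOfHom g) y := hxy
    have h1 : chartMap k (leOfHom g) y ∈ Set.range (chartMap k (leOfHom g)) := ⟨y, rfl⟩
    rw [range_chartMap k (Δ.rational _ υ.2) ⟨m, hm⟩ h, ← hxy'] at h1
    have h2 : x ∈ Set.range (chartMap k (leOfHom f')) := by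
      rw [range_chartMap k (Δ.rational _ σ.2) ⟨m, hmσ⟩
        (fun v : M →ₗ[ℤ] ℝ => show v ∈ σ.1 ⊓ τ.1 ↔ v ∈ σ.1 ∧ v m = 0 from ⟨fun hv => ⟨hv.1, ((h v).1 hv.2).2⟩,
          fun hv => ⟨hv.1, (h v).2 ⟨leOfHom f hv.1, hv.2⟩⟩⟩)]
      intro h3
      refine h1 ?_
      change coordMap k (leOfHom f) (chi k υ.1 ⟨m, hm⟩) ∈
        (show PrimeSpectrum (CoordRing k σ.1) from x).asIdeal
      rw [coordMap_single]
      exact h3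
    obtain ⟨z, hz⟩ := h2
    refine ⟨l, f', g', z, hz, ?_⟩
    refine ((chartFunctor k Δ).map g).isOpenEmbedding.injective ?_
    change chartMap k (leOfHom g) (chartMap k (leOfHom g') z) = chartMap k (leOfHom g) y
    rw [chartMap_chartMap, ← hxy', ← hz, chartMap_chartMap]

/-- The toric variety `X = X_Δ` of the fan `Δ`: the `U_σ` glued along the `U_τ`, `τ` a common
face. -/
def toricVariety : Scheme.{u} := Limits.colimit (chartFunctor k Δ)

/-- The open immersion `U_σ → X`. -/
def chart (σ : Δ.cones) : affineChart k σ.1 ⟶ toricVariety k Δ :=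
  Limits.colimit.ι (chartFunctor k Δ) σ

instance (σ : Δ.cones) : IsOpenImmersion (chart k Δ σ) :=
  inferInstanceAs (IsOpenImmersion (Limits.colimit.ι (chartFunctor k Δ) σ))

lemma exists_chart (x : toricVariety k Δ) : ∃ σ y, chart k Δ σ y = x :=
  Scheme.IsLocallyDirected.ι_jointly_surjective (chartFunctor k Δ) x

lemma chartMap_chart {σ τ : Δ.cones} (h : τ.1 ≤ σ.1) :
    chartMap k h ≫ chart k Δ σ = chart k Δ τ :=
  Limits.colimit.w (chartFunctor k Δ) (homOfLE h : τ ⟶ σ)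

/-- The zero cone; its chart is the torus `Spec k[M]`. -/
def Fan.zeroCone : Δ.cones := ⟨⊥, Δ.zero_mem⟩

/-- A primitive vector of the lattice `N`. -/
def IsPrimitive (n : M →ₗ[ℤ] ℤ) : Prop :=
  ∀ (d : ℤ) (n' : M →ₗ[ℤ] ℤ), n = d • n' → IsUnit d

/-- The half-line generated by `n`. -/
def rayCone (n : M →ₗ[ℤ] ℤ) : PointedCone ℝ (M →ₗ[ℤ] ℝ) := PointedCone.hull ℝ {toReal n}

lemma mem_dualMonoid_rayCone {n : M →ₗ[ℤ] ℤ} {m : M} : m ∈ dualMonoid (rayCone n) ↔ 0 ≤ n m := by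
  have := mem_dualMonoid_hull (S := {n}) (m := m)
  simpa [rayCone] using this

lemma IsPrimitive.exists_apply_eq_one {n : M →ₗ[ℤ] ℤ} (hn : IsPrimitive n) : ∃ m, n m = 1 := by
  obtain ⟨d, hd⟩ := (IsPrincipalIdealRing.principal (LinearMap.range n)).principal
  have hdvd : ∀ m, d ∣ n m := fun m =>
    Ideal.mem_span_singleton.1 (by rw [Ideal.span, ← hd]; exact ⟨m, rfl⟩)
  have hu : IsUnit d := by
    rcases eq_or_ne d 0 with rfl | h0
    · have : n = (0 : ℤ) • n := by ext m; simpa using hdvd m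
      exact hn 0 n this
    · refine hn d
        { toFun := fun m => n m / d
          map_add' := fun a b => by rw [map_add, Int.add_ediv_of_dvd_left (hdvd a)]
          map_smul' := fun c a => by simp [Int.mul_ediv_assoc _ (hdvd a)] } ?_
      ext m
      exact (Int.mul_ediv_cancel' (hdvd m)).symm
  have : (1 : ℤ) ∈ LinearMap.range n := by
    rw [hd]
    exact Ideal.mem_span_singleton.2 hu.dvd
  exact this

/-- The rays of the fan, each given by its primitive generator. -/
def Fan.Ray : Type u := {n : M →ₗ[ℤ] ℤ // IsPrimitive n ∧ rayCone n ∈ Δ.cones}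

variable {Δ} in
/-- The one-dimensional cone of a ray. -/
def Fan.Ray.cone (ρ : Δ.Ray) : Δ.cones := ⟨rayCone ρ.1, ρ.2.2⟩

/-- The ideal, in `k[ρ^∨ ∩ M]`, of the closed torus orbit of `U_ρ` (`ρ` the half-line through `n`):
it is generated by the monomials `x^m` with `⟨m, n⟩ > 0`. -/
def orbitIdeal (n : M →ₗ[ℤ] ℤ) : Ideal (CoordRing k (rayCone n)) :=
  Ideal.span {f | ∃ m : dualMonoid (rayCone n), 0 < n m ∧ f = chi k (rayCone n) m}

/-- The projection of `k[ρ^∨ ∩ M]` onto the span of the monomials `x^m` with `⟨m, n⟩ = 0`. -/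
def orbitRetract (n : M →ₗ[ℤ] ℤ) : CoordRing k (rayCone n) →ₐ[k] CoordRing k (rayCone n) :=
  open Classical in
  AddMonoidAlgebra.lift k _ (dualMonoid (rayCone n))
    { toFun := fun m => if n m.toAdd.1 = 0 then chi k (rayCone n) m.toAdd else 0
      map_one' := by simp [chi, AddMonoidAlgebra.one_def]
      map_mul' := fun a b => by
        have ha := mem_dualMonoid_rayCone.1 a.toAdd.2
        have hb := mem_dualMonoid_rayCone.1 b.toAdd.2
        have : n (a * b).toAdd.1 = n a.toAdd.1 + n b.toAdd.1 := map_add n _ _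
        rw [this]
        by_cases h1 : n a.toAdd.1 = 0 <;> by_cases h2 : n b.toAdd.1 = 0
        · simp [h1, h2]
        · simp [h1, h2]
        · simp [h1, h2]
        · rw [if_neg (by omega), if_neg h1, zero_mul] }

lemma orbitIdeal_eq_ker (n : M →ₗ[ℤ] ℤ) : orbitIdeal k n = RingHom.ker (orbitRetract k n) := by
  refine le_antisymm (Ideal.span_le.2 ?_) fun f hf => ?_
  · rintro _ ⟨m, hm, rfl⟩
    simp [RingHom.mem_ker, orbitRetract, hm.ne']
  · have key : ∀ g, g - orbitRetract k n g ∈ orbitIdeal k n := by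
      intro g
      induction g using AddMonoidAlgebra.induction_linear with
      | zero => simp
      | add a b ha hb => rw [map_add, add_sub_add_comm]; exact add_mem ha hb
      | single m a =>
        rcases (mem_dualMonoid_rayCone.1 m.2).eq_or_lt with h | h
        · simp [orbitRetract, ← h]
        · have : AddMonoidAlgebra.single m a = algebraMap k (CoordRing k (rayCone n)) a *
              chi k (rayCone n) m := by simp [chi]
          have h0 : orbitRetract k n (chi k (rayCone n) m) = 0 := by
            simp [orbitRetract, h.ne']
          rw [this, map_mul, AlgHom.commutes, ← mul_sub, h0, sub_zero]
          exact Ideal.mul_mem_left _ _ (Ideal.subset_span ⟨m, h, rfl⟩)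
    have := key f
    rwa [RingHom.mem_ker.1 hf, sub_zero] at this

lemma orbitIdeal_eq_span {n : M →ₗ[ℤ] ℤ} (m₀ : dualMonoid (rayCone n)) (h : n m₀ = 1) :
    orbitIdeal k n = Ideal.span {chi k (rayCone n) m₀} := by
  refine le_antisymm (Ideal.span_le.2 ?_) ((Ideal.span_singleton_le_iff_mem _).2
    (Ideal.subset_span ⟨m₀, by omega, rfl⟩))
  rintro _ ⟨m, hm, rfl⟩
  have h' : (m : M) - m₀ ∈ dualMonoid (rayCone n) :=
    mem_dualMonoid_rayCone.2 (by rw [map_sub]; omega)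
  refine Ideal.mem_span_singleton.2 ⟨chi k _ ⟨_, h'⟩, ?_⟩
  rw [chi_mul]
  congr 1
  exact Subtype.ext (add_sub_cancel _ _).symm

section Lattice
variable [Module.Free ℤ M] [Module.Finite ℤ M]

instance : IsDomain (AddMonoidAlgebra k M) := by
  have : AddMonoid.FG M := by
    have := Module.Finite.iff_addGroup_fg.1 (inferInstance : Module.Finite ℤ M)
    exact AddGroup.fg_iff_addMonoid_fg.1 this
  have : IsAddTorsionFree M := Module.isTorsionFree_int_iff_isAddTorsionFree.mp inferInstance
  infer_instance

instance (σ : PointedCone ℝ (M →ₗ[ℤ] ℝ)) : IsDomain (CoordRing k σ) :=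
  Function.Injective.isDomain (AddMonoidAlgebra.mapDomainRingHom k (dualMonoid σ).subtype)
    (AddMonoidAlgebra.mapDomain_injective Subtype.val_injective)

lemma isNoetherianRing_coordRing {σ : PointedCone ℝ (M →ₗ[ℤ] ℝ)} (hσ : IsRationalPolyhedral σ) :
    IsNoetherianRing (CoordRing k σ) := by
  have : AddMonoid.FG (dualMonoid σ) := (AddMonoid.fg_iff_addSubmonoid_fg _).2 (dualMonoid_fg hσ)
  exact Algebra.FiniteType.isNoetherianRing k _

instance : IrreducibleSpace (toricVariety k Δ) where
  isPreirreducible_univ := by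
    have hT : IsPreirreducible (Set.range (chart k Δ Δ.zeroCone)) := by
      rw [← Set.image_univ]
      exact (PreirreducibleSpace.isPreirreducible_univ).image _
        (chart k Δ Δ.zeroCone).continuous.continuousOn
    have hd : closure (Set.range (chart k Δ Δ.zeroCone)) = Set.univ := by
      refine Set.eq_univ_of_forall fun x => ?_
      obtain ⟨σ, y, rfl⟩ := exists_chart k Δ x
      rw [mem_closure_iff]
      intro U hU hy
      have h0 : Δ.zeroCone.1 ≤ σ.1 := bot_le
      have hne : (Set.range (chartMap k h0)).Nonempty := ⟨_, ⟨genericPoint _, rfl⟩⟩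
      have ho : IsOpen (Set.range (chartMap k h0)) := by
        have : IsOpenImmersion (chartMap k h0) :=
          inferInstanceAs (IsOpenImmersion ((chartFunctor k Δ).map (homOfLE h0 : Δ.zeroCone ⟶ σ)))
        exact (chartMap k h0).isOpenEmbedding.isOpen_range
      obtain ⟨z, -, hz1, w, hw⟩ := PreirreducibleSpace.isPreirreducible_univ
        (X := affineChart k σ.1) _ _ (hU.preimage (chart k Δ σ).continuous) ho ⟨y, trivial, hy⟩
        (by simpa using hne)
      refine ⟨_, hz1, w, ?_⟩
      rw [← hw, ← Scheme.Hom.comp_apply, chartMap_chart]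
    rw [← hd]
    exact isPreirreducible_iff_closure.2 hT
  toNonempty := ⟨chart k Δ Δ.zeroCone (genericPoint _)⟩

instance : IsIntegral (toricVariety k Δ) := by
  have : AlgebraicGeometry.IsReduced (toricVariety k Δ) := by
    have (i : Δ.cones) : AlgebraicGeometry.IsReduced ((chartFunctor k Δ).obj i) :=
      inferInstanceAs (AlgebraicGeometry.IsReduced (affineChart k i.1))
    have h2 : ∀ i : Δ.cones, AlgebraicGeometry.IsReduced
        ((Scheme.IsLocallyDirected.openCover (chartFunctor k Δ)).X i) := fun i => this i
    exact @AlgebraicGeometry.IsReduced.of_openCover _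
      (Scheme.IsLocallyDirected.openCover (chartFunctor k Δ)) h2
  exact isIntegral_of_irreducibleSpace_of_isReduced _

instance : IsLocallyNoetherian (toricVariety k Δ) := by
  refine (isLocallyNoetherian_iff_openCover
    (Scheme.IsLocallyDirected.openCover (chartFunctor k Δ))).2 fun (i : Δ.cones) => ?_
  have : IsNoetherianRing (CoordRing k i.1) := isNoetherianRing_coordRing k (Δ.rational _ i.2)
  exact inferInstanceAs (IsLocallyNoetherian (Spec (.of (CoordRing k i.1))))

/-- The monomial `x^m`, `m ∈ M`, as a rational function on `X`: the germ at the generic point of the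
regular function `x^m` on the torus. -/
def monomial (m : M) : (toricVariety k Δ).functionField :=
  (toricVariety k Δ).presheaf.germ (chart k Δ Δ.zeroCone ''ᵁ ⊤) (genericPoint _) (by
      have : ((chart k Δ Δ.zeroCone ''ᵁ ⊤ : (toricVariety k Δ).Opens) :
          Set (toricVariety k Δ)).Nonempty :=
        ⟨_, genericPoint _, trivial, rfl⟩
      exact ((genericPoint_spec _).mem_open_set_iff (chart k Δ Δ.zeroCone ''ᵁ ⊤).isOpen).2
        (by simpa using this))
    (((chart k Δ Δ.zeroCone).appIso ⊤).inv
      ((Scheme.ΓSpecIso _).inv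
        (chi k Δ.zeroCone.1 ⟨m, fun v hv => by simp [(Submodule.mem_bot _).1 hv]⟩)))

instance (n : M →ₗ[ℤ] ℤ) : (orbitIdeal k n).IsPrime := by
  rw [orbitIdeal_eq_ker]; exact RingHom.ker_isPrime _

lemma height_orbitIdeal {n : M →ₗ[ℤ] ℤ} (hn : IsPrimitive n) : (orbitIdeal k n).height = 1 := by
  have hr : IsRationalPolyhedral (rayCone n) := ⟨{n}, by simp [rayCone]⟩
  have := isNoetherianRing_coordRing k hr
  obtain ⟨m, hm⟩ := hn.exists_apply_eq_one
  have hp : (orbitIdeal k n).IsPrime := inferInstance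
  rw [orbitIdeal_eq_span k ⟨m, mem_dualMonoid_rayCone.2 (by omega)⟩ hm] at hp ⊢
  refine Ideal.height_span_singleton_eq_one_of_mem_nonZeroDivisors ?_ ?_
  · exact mem_nonZeroDivisors_of_ne_zero (by simp [chi])
  · exact fun hu => hp.ne_top (Ideal.span_singleton_eq_top.2 hu)

/-- The generic point of the closed torus orbit of `U_ρ`. -/
def orbitPoint (n : M →ₗ[ℤ] ℤ) : affineChart k (rayCone n) :=
  (⟨orbitIdeal k n, inferInstance⟩ : PrimeSpectrum (CoordRing k (rayCone n)))

lemma coheight_orbitPoint {n : M →ₗ[ℤ] ℤ} (hn : IsPrimitive n) :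
    Order.coheight (orbitPoint k n) = 1 :=
  (idealHeight_eq_coheight (.of (CoordRing k (rayCone n))) (orbitPoint k n)).symm.trans
    (height_orbitIdeal k hn)

/-- The torus invariant prime divisor `D_ρ`, given by its generic point: the generic point of the
closed torus orbit of `U_ρ`. -/
def rayDivisor {Δ : Fan M} (ρ : Δ.Ray) : PrimeDivisor (toricVariety k Δ) :=
  ⟨chart k Δ ρ.cone (orbitPoint k ρ.1),
    (coheight_eq_of_isOpenImmersion (chart k Δ ρ.cone)).trans (coheight_orbitPoint k ρ.2.1)⟩

end Lattice

end Charts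
end Fan
end

end WeilDeco

/-!
On a noetherian integral scheme with integrally closed stalks, call a decoration of `V` bounded if
every functional on `V` has bounded poles on the vectors whose coefficients are non-negative. At
every codimension-one point `P` these vectors then form a lattice over the discrete valuation ring
`𝒪_P`, hence a free module cut out in `V` by finitely many functionals; as regularity of a function
can be tested in codimension one, the associated sheaf equals its double dual. Clearing the
denominators of the functionals by one section over an affine open set embeds the sections there
into a finite module, which gives coherence.

Over a prime divisor `P` with a lift `t ∈ 𝒪_P` of the prescribed value, the jumping coefficient is
`min (ord_P (f - t g)) (ord_P g + 1)`: it is the order for which `(t, 1)` and `(1, 0)` are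
orthogonal of orders `1` and `0`, and from this the decoration laws and boundedness are evident. For the
monomial `x ^ u_ρ` the lift is the monomial itself, which is regular at `D_ρ` as `⟨u_ρ, ρ⟩ ≥ 0`.

A toric variety is normal because its charts are: if `x ∈ A[M]` is integral over `A[σ^∨ ∩ M]` and
`n` is a generator of `σ`, then the coaction of `n` sends `x` to a Laurent polynomial in `T` which
is integral over the polynomials, hence a polynomial, and so `⟨m, n⟩ ≥ 0` for every `m` in the
support of `x`.
-/

namespace WeilDeco
noncomputable section

section PrimeDivisors
variable {X : Scheme.{u}} [IsIntegral X]

lemma germAt_eq_algebraMap {U : X.Opens} (x : U) {y : X} (hy : y ∈ U) (a : Γ(X, U)) :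
    germAt x a = algebraMap (X.presheaf.stalk y) X.functionField (X.presheaf.germ U y hy a) :=
  haveI : Nonempty U := ⟨x⟩
  (Scheme.algebraMap_germ_eq_germToFunctionField X hy a).symm

lemma PrimeDivisor.eq_of_specializes {P : PrimeDivisor X} {y : X} (h : y ⤳ P.1)
    (hy : y ≠ genericPoint X) : y = P.1 := by
  by_contra hne
  have h_lt : P.1 < y := lt_of_le_not_ge h fun h' => hne (h.antisymm h').eq
  have h_lt_generic : y < genericPoint X :=
    lt_of_le_not_ge (genericPoint_specializes y) fun h' => hy
      (Specializes.antisymm h' (genericPoint_specializes y)).eq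
  have hP := Order.coheight_add_one_le h_lt
  have hy_pos := le_add_self.trans (Order.coheight_add_one_le h_lt_generic)
  rw [P.2] at hP
  exact absurd ((add_le_add_left hy_pos 1).trans hP) (by norm_num)

lemma PrimeDivisor.ne_genericPoint (P : PrimeDivisor X) : P.1 ≠ genericPoint X := fun h => by
  have : Order.coheight (genericPoint X) = 0 :=
    Order.coheight_eq_zero.2 fun y _ => genericPoint_specializes y
  exact zero_ne_one (this.symm.trans (h ▸ P.2))

lemma exists_open_avoiding (P : PrimeDivisor X) {S : Set (PrimeDivisor X)} (hS : S.Finite) :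
    ∃ U : X.Opens, P.1 ∈ U ∧ ∀ Q : PrimeDivisor X, Q.1 ∈ U → Q ∈ S → Q = P := by
  refine ⟨⟨(⋃ Q ∈ S \ {P}, closure {Q.1})ᶜ,
    ((hS.subset Set.sdiff_subset).isClosed_biUnion fun _ _ => isClosed_closure).isOpen_compl⟩,
    ?_, fun Q hQ hQS => ?_⟩
  · change P.1 ∉ _
    simp only [Set.mem_iUnion, not_exists]
    intro Q hQ h
    exact hQ.2 (Subtype.ext (P.eq_of_specializes (specializes_iff_mem_closure.2 h)
      Q.ne_genericPoint))
  · by_contra hne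
    exact hQ (Set.mem_biUnion (show Q ∈ S \ {P} from ⟨hQS, hne⟩) (subset_closure rfl))

lemma exists_open_forall_notMem {S : Set (PrimeDivisor X)} (hS : S.Finite) :
    ∃ U : X.Opens, genericPoint X ∈ U ∧ ∀ P ∈ S, P.1 ∉ U := by
  refine ⟨⟨(⋃ P ∈ S, closure {P.1})ᶜ,
    (hS.isClosed_biUnion fun _ _ => isClosed_closure).isOpen_compl⟩, ?_,
    fun P hP h => h (Set.mem_biUnion hP (subset_closure rfl))⟩
  change genericPoint X ∉ _
  simp only [Set.mem_iUnion, not_exists]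
  exact fun P _ h => P.ne_genericPoint (Specializes.antisymm
    (specializes_iff_mem_closure.2 h) (genericPoint_specializes P.1)).eq

instance (P : PrimeDivisor X) : Ring.KrullDimLE 1 (X.presheaf.stalk P.1) :=
  krullDimLE_of_coheight_le P.2.le

variable [IsLocallyNoetherian X]

lemma finite_primeDivisor_notMem [CompactSpace X] (U : X.Opens) [Nonempty U] :
    {P : PrimeDivisor X | P.1 ∉ U}.Finite := by
  have : IsNoetherian X := {}
  obtain ⟨S, hS, hS_closed, hS_irred, hS_union⟩ :=
    NoetherianSpace.exists_finite_set_isClosed_irreducible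
      (α := X) (s := (U : Set X)ᶜ) U.isOpen.isClosed_compl
  refine Set.Finite.of_finite_image (f := fun P : PrimeDivisor X => closure {P.1})
    (hS.subset ?_) fun P _ Q _ h => Subtype.ext (inseparable_iff_closure_eq.2 h).eq
  rintro _ ⟨P, hP, rfl⟩
  obtain ⟨C, hC, hPC⟩ := hS_union.subset (show P.1 ∈ (U : Set X)ᶜ from hP)
  obtain ⟨y, hy⟩ := QuasiSober.sober (hS_irred C hC) (hS_closed C hC)
  have hyU : y ∉ U := hS_union.superset ⟨C, hC, hy.mem⟩
  have hyP : y = P.1 := P.eq_of_specializes (hy.specializes hPC) fun h =>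
    hyU (h ▸ ((genericPoint_spec X).mem_open_set_iff U.isOpen).2 (by simpa using ‹Nonempty U›))
  change closure {P.1} ∈ S
  rwa [← hyP, hy.def]

end PrimeDivisors

section Order
variable {X : Scheme.{u}} [IsIntegral X] [IsLocallyNoetherian X]

lemma ordTop_of_ne {P : PrimeDivisor X} {f : X.functionField} (hf : f ≠ 0) :
    ordTop P f = (Scheme.ord f P.1 : ℤ) := if_neg hf

lemma finite_ordTop_ne_zero [CompactSpace X] {f : X.functionField} (hf : f ≠ 0) :
    {P : PrimeDivisor X | ordTop P f ≠ 0}.Finite := by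
  obtain ⟨U, -, a, hU, rfl, ha⟩ := exists_isUnit_germ_eq X f hf
  refine (finite_primeDivisor_notMem U).subset fun P hP hPU => hP ?_
  rw [ordTop_of_ne hf]
  exact congrArg _ (Scheme.ord_of_isUnit ha hPU)

lemma ordTop_germAt_nonneg {U : X.Opens} (x : U) (a : Γ(X, U)) {P : PrimeDivisor X}
    (hP : P.1 ∈ U) : 0 ≤ ordTop P (germAt x a) :=
  haveI : Nonempty U := ⟨x⟩
  ordTop_germ_nonneg P hP a

lemma ordTop_algebraMap_nonneg (P : PrimeDivisor X) (a : X.presheaf.stalk P.1) :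
    0 ≤ ordTop P (algebraMap _ X.functionField a) := by
  obtain ⟨U, hPU, b, rfl⟩ := X.presheaf.exists_germ_eq a
  rw [← germAt_eq_algebraMap ⟨P.1, hPU⟩]
  exact ordTop_germAt_nonneg _ b hPU

variable [∀ x : X, IsIntegrallyClosed (X.presheaf.stalk x)]

instance isDiscreteValuationRing_stalk (P : PrimeDivisor X) :
    IsDiscreteValuationRing (X.presheaf.stalk P.1) := by
  have h_dim : ringKrullDim (X.presheaf.stalk P.1) = 1 := by
    rw [ringKrullDim_stalk_eq_coheight, P.2]; rfl
  have h_field : ¬ IsField (X.presheaf.stalk P.1) := fun h =>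
    zero_ne_one ((ringKrullDim_eq_zero_of_isField h).symm.trans h_dim)
  have : IsDedekindDomain (X.presheaf.stalk P.1) :=
    { maximalOfPrime := fun h0 hp => hp.isMaximal_of_ne_bot h0 }
  exact ((IsDiscreteValuationRing.TFAE _ h_field).out 2 0).1 this

/-- The order of vanishing along `P` as an additive valuation of the function field. -/
def ordVal (P : PrimeDivisor X) : AddValuation X.functionField (WithTop ℤ) :=
  AddValuation.of (ordTop P) (if_pos rfl)
    (by
      have h := Scheme.ord_mul (x := P.1) (one_ne_zero (α := X.functionField)) one_ne_zero
      rw [mul_one, left_eq_add] at h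
      rw [ordTop_of_ne one_ne_zero, h]; rfl)
    (fun f g => by
      rcases eq_or_ne f 0 with rfl | hf
      · rw [zero_add]; exact min_le_right _ _
      rcases eq_or_ne g 0 with rfl | hg
      · rw [add_zero]; exact min_le_left _ _
      rcases eq_or_ne (f + g) 0 with hfg | hfg
      · simp [hfg, ordTop]
      rw [ordTop_of_ne hf, ordTop_of_ne hg, ordTop_of_ne hfg]
      exact_mod_cast Scheme.ord_add (x := P.1) hfg)
    (fun f g => by
      rcases eq_or_ne f 0 with rfl | hf
      · simp [ordTop]
      rcases eq_or_ne g 0 with rfl | hg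
      · simp [ordTop]
      rw [ordTop_of_ne hf, ordTop_of_ne hg, ordTop_of_ne (mul_ne_zero hf hg),
        Scheme.ord_mul hf hg]
      rfl)

@[simp] lemma ordVal_apply (P : PrimeDivisor X) (f : X.functionField) : ordVal P f = ordTop P f :=
  rfl

variable {P : PrimeDivisor X}

lemma ordTop_zero : ordTop P (0 : X.functionField) = ⊤ := (ordVal P).map_zero

lemma ordTop_one : ordTop P (1 : X.functionField) = 0 := (ordVal P).map_one

lemma ordTop_mul (f g : X.functionField) : ordTop P (f * g) = ordTop P f + ordTop P g :=
  (ordVal P).map_mul f g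

lemma ordTop_ne_top {f : X.functionField} : ordTop P f ≠ ⊤ ↔ f ≠ 0 := (ordVal P).ne_top_iff

lemma ordTop_algebraMap_eq_zero_iff {a : X.presheaf.stalk P.1} :
    ordTop P (algebraMap _ X.functionField a) = 0 ↔ IsUnit a := by
  rcases eq_or_ne a 0 with rfl | ha
  · simp [ordTop_zero]
  have ha' : algebraMap _ X.functionField a ≠ 0 := by
    rwa [Ne, IsFractionRing.to_map_eq_zero_iff (K := X.functionField)]
  rw [Ring.isUnit_iff_ordFrac_one_of_isDiscreteValuationRing (K := X.functionField),
    ordTop_of_ne ha', ← WithTop.coe_zero, WithTop.coe_inj, Scheme.ord_eq_iff P.2 ha']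
  rfl

lemma ordTop_nonneg_iff {f : X.functionField} :
    0 ≤ ordTop P f ↔ ∃ a : X.presheaf.stalk P.1, algebraMap _ X.functionField a = f := by
  refine ⟨fun h => ?_, fun ⟨a, ha⟩ => ha ▸ ordTop_algebraMap_nonneg P a⟩
  rcases eq_or_ne f 0 with rfl | hf
  · exact ⟨0, map_zero _⟩
  rcases ValuationRing.isInteger_or_isInteger (X.presheaf.stalk P.1) f with hf' | ⟨a, ha⟩
  · exact hf'
  have h_sum : ordTop P f + ordTop P (algebraMap _ X.functionField a) = 0 := by
    rw [ha, ← ordTop_mul, mul_inv_cancel₀ hf, ordTop_one]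
  have ha_unit : IsUnit a := ordTop_algebraMap_eq_zero_iff.1 <|
    le_antisymm ((le_add_of_nonneg_left h).trans_eq h_sum) (ordTop_algebraMap_nonneg P a)
  refine ⟨↑ha_unit.unit⁻¹, ?_⟩
  rw [map_units_inv, IsUnit.unit_spec, ha, inv_inv]

lemma one_le_ordTop_algebraMap_iff {a : X.presheaf.stalk P.1} :
    1 ≤ ordTop P (algebraMap _ X.functionField a) ↔ X.residue P.1 a = 0 := by
  have h_residue : X.residue P.1 a = 0 ↔ ¬ IsUnit a := IsLocalRing.residue_eq_zero_iff a
  rw [h_residue, ← ordTop_algebraMap_eq_zero_iff]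
  have h_nonneg := ordTop_algebraMap_nonneg P a
  revert h_nonneg
  generalize ordTop P (algebraMap _ X.functionField a) = n
  cases n
  · simp
  · norm_cast; lia

lemma exists_ordTop_eq_one (P : PrimeDivisor X) : ∃ π : X.functionField, ordTop P π = 1 := by
  obtain ⟨ϖ, hϖ⟩ := IsDiscreteValuationRing.exists_irreducible (X.presheaf.stalk P.1)
  have h0 : algebraMap _ X.functionField ϖ ≠ 0 := by
    rw [Ne, IsFractionRing.to_map_eq_zero_iff (K := X.functionField)]
    exact hϖ.ne_zero
  refine ⟨algebraMap _ _ ϖ, ?_⟩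
  rw [ordTop_of_ne h0, (Scheme.ord_eq_iff P.2 h0 (n := 1)).2]
  · rfl
  · exact Ring.ordFrac_irreducible (K := X.functionField) hϖ

end Order

section HeightOne
variable {A K : Type*} [CommRing A] [IsDomain A] [Field K] [Algebra A K] [IsFractionRing A K]

lemma colon_singleton_ne_bot (y : K) : (1 : Submodule A K).colon {y} ≠ ⊥ := by
  obtain ⟨a, b, hb, rfl⟩ := IsFractionRing.div_surjective (A := A) y
  refine (Submodule.ne_bot_iff _).2 ⟨b, Submodule.mem_colon_singleton.2 ?_,
    nonZeroDivisors.ne_zero hb⟩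
  rw [Algebra.smul_def, mul_div_cancel₀ _ (IsFractionRing.to_map_ne_zero_of_mem_nonZeroDivisors hb)]
  exact Submodule.mem_one.2 ⟨a, rfl⟩

variable [IsNoetherianRing A] [IsIntegrallyClosed A]

lemma exists_smul_notMem_colon_singleton {y : K} (hy : y ∉ (1 : Submodule A K)) :
    ∃ t ∈ (1 : Submodule A K).colon {y}, ∃ s ∉ (1 : Submodule A K).colon {y},
      algebraMap A K s = t • y := by
  by_contra! h
  -- otherwise multiplication by `y` preserves the image of the ideal `(A : y)`
  refine hy (Submodule.mem_one.2 (IsIntegrallyClosed.isIntegral_iff.1 ?_))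
  refine isIntegral_of_smul_mem_submodule (R := A) (M := K)
    (Submodule.map (Algebra.linearMap A K) ((1 : Submodule A K).colon {y})) ?_
    ((IsNoetherian.noetherian _).map _) y ?_
  · obtain ⟨r, hr, hr0⟩ := (Submodule.ne_bot_iff _).1 (colon_singleton_ne_bot (A := A) y)
    exact (Submodule.ne_bot_iff _).2 ⟨_, ⟨r, hr, rfl⟩,
      (IsFractionRing.to_map_eq_zero_iff (K := K)).not.2 hr0⟩
  · rintro _ ⟨r, hr, rfl⟩
    obtain ⟨a, ha⟩ := Submodule.mem_one.1 (Submodule.mem_colon_singleton.1 hr)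
    refine ⟨a, by_contra fun haI => h r hr a haI ha, ?_⟩
    rw [Algebra.linearMap_apply, ha, Algebra.linearMap_apply, Algebra.smul_def, smul_eq_mul,
      mul_comm]

lemma height_colon_singleton_eq_one {y : K} (hp : ((1 : Submodule A K).colon {y}).IsPrime) :
    ((1 : Submodule A K).colon {y}).height = 1 := by
  have hy : y ∉ (1 : Submodule A K) := fun h => hp.ne_top <|
    (Ideal.eq_top_iff_one _).2 (Submodule.mem_colon_singleton.2 (by rwa [one_smul]))
  obtain ⟨t, ht, s, hs, hst⟩ := exists_smul_notMem_colon_singleton hy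
  have h_minimal : (1 : Submodule A K).colon {y} ∈ (Ideal.span {t}).minimalPrimes := by
    refine ⟨⟨hp, (Ideal.span_singleton_le_iff_mem _).2 ht⟩, fun q ⟨hq, htq⟩ hqp r hr => ?_⟩
    obtain ⟨a, ha⟩ := Submodule.mem_one.1 (Submodule.mem_colon_singleton.1 hr)
    have h_eq : r * s = a * t := IsFractionRing.injective A K <| by
      rw [map_mul, map_mul, ha, hst, Algebra.smul_def, Algebra.smul_def]; ring
    refine (hq.mem_or_mem (?_ : r * s ∈ q)).resolve_right fun h => hs (hqp h)
    exact h_eq ▸ q.mul_mem_left a ((Ideal.span_singleton_le_iff_mem _).1 htq)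
  refine le_antisymm (Ideal.height_le_one_of_isPrincipal_of_mem_minimalPrimes _ _ h_minimal) ?_
  rw [Order.one_le_iff_ne_zero, Ne, Ideal.height_eq_zero_iff,
    IsDomain.minimalPrimes_eq_singleton_bot]
  exact colon_singleton_ne_bot y

lemma mem_one_of_forall_height_eq_one {x : K}
    (hx : ∀ p : Ideal A, p.IsPrime → p.height = 1 → ∃ s ∉ p, s • x ∈ (1 : Submodule A K)) :
    x ∈ (1 : Submodule A K) := by
  by_contra hx_notMem
  have h_ne : Submodule.Quotient.mk (p := (1 : Submodule A K)) x ≠ 0 := by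
    rwa [Ne, Submodule.Quotient.mk_eq_zero]
  obtain ⟨p, hp, hxp⟩ := exists_le_isAssociatedPrime_of_isNoetherianRing A _ h_ne
  obtain ⟨hp_prime, z, hz⟩ := isAssociatedPrime_iff.1 hp
  obtain ⟨y, rfl⟩ := Submodule.Quotient.mk_surjective _ z
  have h_colon (y' : K) : (⊥ : Submodule A (K ⧸ (1 : Submodule A K))).colon
      {Submodule.Quotient.mk y'} = (1 : Submodule A K).colon {y'} := by
    ext r
    simp only [Submodule.mem_colon_singleton, ← Submodule.Quotient.mk_smul, Submodule.mem_bot,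
      Submodule.Quotient.mk_eq_zero]
  rw [h_colon] at hz hxp
  subst hz
  obtain ⟨s, hs, hsx⟩ := hx _ hp_prime (height_colon_singleton_eq_one hp_prime)
  exact hs (hxp (Submodule.mem_colon_singleton.2 hsx))

end HeightOne

section Hartogs
variable {X : Scheme.{u}}

lemma fromSpec_mem {U : X.Opens} (hU : IsAffineOpen U) (q : PrimeSpectrum Γ(X, U)) :
    hU.fromSpec q ∈ U := by
  rw [← SetLike.mem_coe, ← hU.range_fromSpec]
  exact ⟨q, rfl⟩

lemma fromSpec_image_top {U : X.Opens} (hU : IsAffineOpen U) :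
    hU.fromSpec ''ᵁ ⊤ = U := by
  rw [Scheme.Hom.image_top_eq_opensRange, hU.opensRange_fromSpec]

variable [IsIntegral X]

lemma section_ext {V : X.Opens} {a b : Γ(X, V)}
    (h : ∀ x : V, (germAt x a : X.functionField) = germAt x b) : a = b := by
  refine TopCat.Presheaf.section_ext X.sheaf V a b fun x hx => ?_
  have : Nonempty V := ⟨⟨x, hx⟩⟩
  rw [Scheme.germToFunctionField_injective X V (h ⟨x, hx⟩)]

lemma germAt_injective {U : X.Opens} (x : U) :
    Function.Injective (germAt x : Γ(X, U) →+* X.functionField) :=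
  haveI : Nonempty U := ⟨x⟩
  Scheme.germToFunctionField_injective X U

lemma exists_germAt_eq_of_cover (f : X.functionField) (V : X.Opens)
    (h : ∀ x ∈ V, ∃ U : X.Opens, x ∈ U ∧ U ≤ V ∧ ∃ a : Γ(X, U), ∀ y : U, germAt y a = f) :
    ∃ a : Γ(X, V), ∀ x : V, germAt x a = f := by
  choose U hxU hUV a ha using h
  obtain ⟨s, hs, -⟩ := X.sheaf.existsUnique_gluing' (fun x : V => U x.1 x.2) V
    (fun x => homOfLE (hUV _ _)) (fun x hx => Opens.mem_iSup.2 ⟨⟨x, hx⟩, hxU x hx⟩)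
    (fun x => a x.1 x.2) fun x y => section_ext (X := X) fun z =>
      (germAt_map inf_le_left z _).trans <|
        ((ha _ _ _).trans (ha _ _ _).symm).trans (germAt_map inf_le_right z _).symm
  exact ⟨s, fun x => (germAt_map (hUV x.1 x.2) ⟨x.1, hxU x.1 x.2⟩ s).symm.trans <|
    (congrArg (germAt _) (hs x)).trans (ha _ _ _)⟩

lemma isIntegrallyClosed_of_isAffineOpen [∀ x : X, IsIntegrallyClosed (X.presheaf.stalk x)]
    {U : X.Opens} (hU : IsAffineOpen U) [Nonempty U] : IsIntegrallyClosed Γ(X, U) := by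
  refine IsIntegrallyClosed.of_localization_maximal fun p _ _ => ?_
  let q : PrimeSpectrum Γ(X, U) := ⟨p, inferInstance⟩
  let := TopCat.Presheaf.algebra_section_stalk X.presheaf ⟨_, fromSpec_mem hU q⟩
  have : IsLocalization.AtPrime (X.presheaf.stalk (hU.fromSpec q)) p :=
    hU.isLocalization_stalk' q (fromSpec_mem hU q)
  exact .of_equiv (IsLocalization.algEquiv p.primeCompl (X.presheaf.stalk (hU.fromSpec q))
    (Localization.AtPrime p)).toRingEquiv

variable [IsLocallyNoetherian X] [∀ x : X, IsIntegrallyClosed (X.presheaf.stalk x)]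

lemma exists_germToFunctionField_eq_of_isAffineOpen {U : X.Opens} (hU : IsAffineOpen U)
    [Nonempty U] (f : X.functionField) (h : ∀ P : PrimeDivisor X, P.1 ∈ U → 0 ≤ ordTop P f) :
    ∃ a : Γ(X, U), X.germToFunctionField U a = f := by
  have := functionField_isFractionRing_of_isAffineOpen X U hU
  have := isIntegrallyClosed_of_isAffineOpen hU
  have : IsNoetherianRing Γ(X, U) := IsLocallyNoetherian.component_noetherian ⟨U, hU⟩
  refine Submodule.mem_one.1 (mem_one_of_forall_height_eq_one (A := Γ(X, U)) fun p hp hht => ?_)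
  let q : PrimeSpectrum Γ(X, U) := ⟨p, hp⟩
  have hqU := fromSpec_mem hU q
  have hq : Order.coheight (hU.fromSpec q) = 1 :=
    (coheight_eq_of_isOpenImmersion hU.fromSpec).trans
      ((idealHeight_eq_coheight Γ(X, U) q).symm.trans hht)
  obtain ⟨b, rfl⟩ := ordTop_nonneg_iff.1 (h ⟨_, hq⟩ hqU)
  let := TopCat.Presheaf.algebra_section_stalk X.presheaf ⟨_, hqU⟩
  have : IsLocalization.AtPrime (X.presheaf.stalk (hU.fromSpec q)) p :=
    hU.isLocalization_stalk' q hqU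
  obtain ⟨⟨r, s⟩, hrs⟩ := IsLocalization.surj p.primeCompl b
  have h_alg (t : Γ(X, U)) : algebraMap Γ(X, U) X.functionField t =
      algebraMap (X.presheaf.stalk (hU.fromSpec q)) X.functionField
        (algebraMap Γ(X, U) (X.presheaf.stalk (hU.fromSpec q)) t) :=
    germAt_eq_algebraMap ⟨_, hqU⟩ hqU t
  refine ⟨s.1, s.2, Submodule.mem_one.2 ⟨r, ?_⟩⟩
  rw [Algebra.smul_def, h_alg, h_alg, ← map_mul, mul_comm]
  exact congrArg _ hrs.symm

lemma exists_germAt_eq (f : X.functionField) (V : X.Opens)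
    (h : ∀ P : PrimeDivisor X, P.1 ∈ V → 0 ≤ ordTop P f) :
    ∃ a : Γ(X, V), ∀ x : V, germAt x a = f := by
  refine exists_germAt_eq_of_cover f V fun x hx => ?_
  obtain ⟨_, ⟨U, hU, rfl⟩, hxU, hUV⟩ := X.isBasis_affineOpens.exists_subset_of_mem_open hx V.isOpen
  have : Nonempty U := ⟨⟨x, hxU⟩⟩
  obtain ⟨a, ha⟩ :=
    exists_germToFunctionField_eq_of_isAffineOpen hU f fun P hP => h P (hUV hP)
  exact ⟨U, hxU, hUV, a, fun _ => ha⟩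

end Hartogs

section GenericFiber
variable {X : Scheme.{u}} [IsIntegral X]

lemma genericPoint_mem {V : X.Opens} (x : V) : genericPoint X ∈ V :=
  ((genericPoint_spec X).mem_open_set_iff V.isOpen).2 ⟨x.1, trivial, x.2⟩

/-- A realization of a presheaf of modules as a presheaf of constant functions with values in a
vector space over the function field, every vector of which occurs on some non-empty open set.
That an open set is non-empty is expressed by its containing the generic point. -/
structure GenericFiber (P : X.PresheafOfModules) (E : Type u) [AddCommGroup E]
    [Module X.functionField E] where
  val : ∀ {V : X.Opens}, genericPoint X ∈ V → P.obj (op V) → E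
  val_add : ∀ {V : X.Opens} (hV : genericPoint X ∈ V) (s t : P.obj (op V)),
    val hV (s + t) = val hV s + val hV t
  val_smul : ∀ {V : X.Opens} (hV : genericPoint X ∈ V) (a : Γ(X, V)) (s : P.obj (op V)),
    val hV (a • s) = germAt ⟨_, hV⟩ a • val hV s
  val_res : ∀ {V W : X.Opens} (h : W ≤ V) (hW : genericPoint X ∈ W) (s : P.obj (op V)),
    val hW (P.restrictₛₗ (homOfLE h).op s) = val (h hW) s
  ext : ∀ {V : X.Opens} {s t : P.obj (op V)}, (∀ hV, val hV s = val hV t) → s = t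
  exists_val_eq : ∀ e : E, ∃ (V : X.Opens) (hV : genericPoint X ∈ V) (s : P.obj (op V)),
    val hV s = e

namespace GenericFiber
variable {P : X.PresheafOfModules} {E : Type u} [AddCommGroup E] [Module X.functionField E]
  (G : GenericFiber P E)

lemma exists_val_eq_of_le (e : E) {U : X.Opens} (hU : genericPoint X ∈ U) :
    ∃ V ≤ U, ∃ (hV : genericPoint X ∈ V) (s : P.obj (op V)), G.val hV s = e := by
  obtain ⟨V, hV, s, rfl⟩ := G.exists_val_eq e
  exact ⟨U ⊓ V, inf_le_left, ⟨hU, hV⟩, P.restrictₛₗ (homOfLE inf_le_right).op s, G.val_res _ _ _⟩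

lemma res_eq_res {V W : X.Opens} (hV : genericPoint X ∈ V) (hW : genericPoint X ∈ W)
    {s : P.obj (op V)} {t : P.obj (op W)} (h : G.val hV s = G.val hW t) :
    P.restrictₛₗ (homOfLE (inf_le_left : V ⊓ W ≤ V)).op s =
      P.restrictₛₗ (homOfLE (inf_le_right : V ⊓ W ≤ W)).op t :=
  G.ext fun hVW => (G.val_res inf_le_left hVW s).trans <|
    h.trans (G.val_res inf_le_right hVW t).symm

lemma exists_linearMap {A : Type*} [AddCommGroup A] [Module X.functionField A] {U : X.Opens}
    (hU : genericPoint X ∈ U)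
    (ψ : ∀ {V : X.Opens}, V ≤ U → genericPoint X ∈ V → P.obj (op V) → A)
    (ψ_add : ∀ {V : X.Opens} (hVU : V ≤ U) (hV : genericPoint X ∈ V) (s t : P.obj (op V)),
      ψ hVU hV (s + t) = ψ hVU hV s + ψ hVU hV t)
    (ψ_smul : ∀ {V : X.Opens} (hVU : V ≤ U) (hV : genericPoint X ∈ V) (a : Γ(X, V))
      (s : P.obj (op V)), ψ hVU hV (a • s) = (germAt ⟨_, hV⟩ a : X.functionField) • ψ hVU hV s)
    (ψ_res : ∀ {V W : X.Opens} (hVU : V ≤ U) (h : W ≤ V) (hW : genericPoint X ∈ W)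
      (s : P.obj (op V)),
      ψ (h.trans hVU) hW (P.restrictₛₗ (homOfLE h).op s) = ψ hVU (h hW) s) :
    ∃ l : E →ₗ[X.functionField] A, ∀ {V : X.Opens} (hVU : V ≤ U) (hV : genericPoint X ∈ V)
      (s : P.obj (op V)), l (G.val hV s) = ψ hVU hV s := by
  choose V hVU hV s hs using fun e => G.exists_val_eq_of_le e hU
  have h_eq (e : E) {W : X.Opens} (hWU : W ≤ U) (hW : genericPoint X ∈ W) (t : P.obj (op W))
      (ht : G.val hW t = e) : ψ (hVU e) (hV e) (s e) = ψ hWU hW t := by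
    rw [← ψ_res (hVU e) inf_le_left ⟨hV e, hW⟩, ← ψ_res hWU inf_le_right ⟨hV e, hW⟩,
      G.res_eq_res (hV e) hW ((hs e).trans ht.symm)]
  refine ⟨{ toFun e := ψ (hVU e) (hV e) (s e)
            map_add' e f := ?_
            map_smul' c e := ?_ }, fun hWU hW t => h_eq _ hWU hW t rfl⟩
  · have hW : genericPoint X ∈ V e ⊓ V f := ⟨hV e, hV f⟩
    rw [h_eq (e + f) (inf_le_left.trans (hVU e)) hW (P.restrictₛₗ (homOfLE inf_le_left).op (s e) +
      P.restrictₛₗ (homOfLE inf_le_right).op (s f)) (by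
        rw [G.val_add, G.val_res, G.val_res, hs, hs]), ψ_add, ψ_res (hVU e)]
    exact congrArg _ (ψ_res (hVU f) inf_le_right hW (s f))
  · obtain ⟨W, hW, a, ha⟩ := X.presheaf.exists_germ_eq c
    have hVW : genericPoint X ∈ V e ⊓ W := ⟨hV e, hW⟩
    have ha' : germAt ⟨_, hVW⟩ (X.presheaf.map (homOfLE inf_le_right).op a) = c :=
      (germAt_map inf_le_right _ a).trans ha
    rw [h_eq (c • e) (inf_le_left.trans (hVU e)) hVW
      ((X.presheaf.map (homOfLE inf_le_right).op a : Γ(X, V e ⊓ W)) •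
        P.restrictₛₗ (homOfLE inf_le_left).op (s e)) (by rw [G.val_smul, G.val_res, hs, ha']),
      ψ_smul, ha', ψ_res (hVU e), RingHom.id_apply]

lemma exists_functional {U : X.Opens} (hU : genericPoint X ∈ U) (φ : DualSection P U) :
    ∃ l : Module.Dual X.functionField E, ∀ {V : X.Opens} (hVU : V ≤ U) (hV : genericPoint X ∈ V)
      (s : P.obj (op V)), l (G.val hV s) = germAt ⟨_, hV⟩ (φ.app V hVU s) :=
  G.exists_linearMap hU (fun hVU hV s => germAt ⟨_, hV⟩ (φ.app _ hVU s))
    (fun _ _ _ _ => by rw [map_add, map_add])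
    (fun _ _ _ _ => by rw [map_smul, smul_eq_mul, map_mul, smul_eq_mul])
    (fun _ h _ _ => by rw [← φ.compat, germAt_map h])

/-- The functional on the generic fiber given by a section of the dual. -/
def functional {U : X.Opens} (hU : genericPoint X ∈ U) (φ : DualSection P U) :
    Module.Dual X.functionField E :=
  (G.exists_functional hU φ).choose

lemma functional_val {U : X.Opens} (hU : genericPoint X ∈ U) (φ : DualSection P U) {V : X.Opens}
    (hVU : V ≤ U) (hV : genericPoint X ∈ V) (s : P.obj (op V)) :
    G.functional hU φ (G.val hV s) = germAt ⟨_, hV⟩ (φ.app V hVU s) :=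
  (G.exists_functional hU φ).choose_spec hVU hV s

lemma functional_eq {U : X.Opens} (hU : genericPoint X ∈ U) {φ : DualSection P U}
    {l : Module.Dual X.functionField E}
    (h : ∀ {V : X.Opens} (hVU : V ≤ U) (hV : genericPoint X ∈ V) (s : P.obj (op V)),
      l (G.val hV s) = germAt ⟨_, hV⟩ (φ.app V hVU s)) : G.functional hU φ = l := by
  ext e
  obtain ⟨V, hVU, hV, s, rfl⟩ := G.exists_val_eq_of_le e hU
  rw [G.functional_val hU φ hVU, h hVU]

/-- The dual of a realized presheaf is realized in the dual vector space, provided that every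
functional is a section of the dual over some non-empty open set. -/
def dual (h_functional : ∀ l : Module.Dual X.functionField E, ∃ (V : X.Opens)
      (hV : genericPoint X ∈ V) (φ : DualSection P V), G.functional hV φ = l) :
    GenericFiber (dual P) (Module.Dual X.functionField E) where
  val {V} hV φ := G.functional hV (show DualSection P V from φ)
  val_add {V} hV φ ψ := by
    refine G.functional_eq _ fun hWV hW s => ?_
    rw [LinearMap.add_apply, G.functional_val hV _ hWV, G.functional_val hV _ hWV, ← map_add]
    rfl
  val_smul {V} hV a φ := by
    refine G.functional_eq _ fun hWV hW s => ?_
    rw [LinearMap.smul_apply, G.functional_val hV _ hWV, ← germAt_map hWV ⟨_, hW⟩, smul_eq_mul,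
      ← map_mul]
    rfl
  val_res h hW φ := G.functional_eq _ fun hWV hW s => G.functional_val _ _ (hWV.trans h) hW s
  ext {V φ ψ} h := by
    refine DualSection.ext (funext fun W => funext fun hWV => LinearMap.ext fun s => ?_)
    refine section_ext fun x => ?_
    have hW := genericPoint_mem x
    exact (G.functional_val (hWV hW) φ hWV hW s).symm.trans <|
      (LinearMap.congr_fun (h (hWV hW)) _).trans (G.functional_val (hWV hW) ψ hWV hW s)
  exists_val_eq := h_functional

lemma germAt_evalDual_app {U V : X.Opens} (s : P.obj (op U)) (hVU : V ≤ U)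
    (hV : genericPoint X ∈ V) (φ : DualSection P V) :
    germAt ⟨_, hV⟩ ((evalDual U s).app V hVU φ) = G.functional hV φ (G.val (hVU hV) s) := by
  rw [← G.val_res hVU, G.functional_val hV φ le_rfl]
  rfl

variable [Module.Finite X.functionField E]
  (h_functional : ∀ l : Module.Dual X.functionField E, ∃ (V : X.Opens)
    (hV : genericPoint X ∈ V) (φ : DualSection P V), G.functional hV φ = l)

include h_functional in
lemma injective_evalDual (U : X.Opens) : Function.Injective (evalDual (P := P) U) := by
  refine fun s t hst => G.ext fun hU => ?_
  rw [← sub_eq_zero, ← Module.forall_dual_apply_eq_zero_iff X.functionField]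
  intro l
  obtain ⟨V, hVU, hV, φ, hφ⟩ := (G.dual h_functional).exists_val_eq_of_le l hU
  have hs := G.germAt_evalDual_app s hVU hV φ
  rw [hst, G.germAt_evalDual_app t hVU hV φ] at hs
  rw [← hφ, map_sub, sub_eq_zero]
  exact hs.symm

include h_functional in
lemma bijective_evalDual (U : X.Opens)
    (h_mem : ∀ e : E, (∀ {V : X.Opens} (_ : V ≤ U) (hV : genericPoint X ∈ V)
      (φ : DualSection P V), ∃ a : Γ(X, V), germAt ⟨_, hV⟩ a = G.functional hV φ e) →
      ∃ s : P.obj (op U), ∀ hU, G.val hU s = e) :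
    Function.Bijective (evalDual (P := P) U) := by
  refine ⟨G.injective_evalDual h_functional U, fun Φ => ?_⟩
  obtain ⟨e, he⟩ : ∃ e : E, ∀ {V : X.Opens} (hVU : V ≤ U) (hV : genericPoint X ∈ V)
      (φ : DualSection P V), germAt ⟨_, hV⟩ (Φ.app V hVU φ) = G.functional hV φ e := by
    by_cases hU : genericPoint X ∈ U
    · refine ⟨(Module.evalEquiv X.functionField E).symm
        ((G.dual h_functional).functional hU Φ), fun hVU hV φ => ?_⟩
      rw [Module.apply_evalEquiv_symm_apply]
      exact ((G.dual h_functional).functional_val hU Φ hVU hV φ).symm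
    · exact ⟨0, fun hVU hV => absurd (hVU hV) hU⟩
  obtain ⟨s, hs⟩ := h_mem e fun hVU hV φ => ⟨_, he hVU hV φ⟩
  refine ⟨s, DualSection.ext (funext fun V => funext fun hVU => LinearMap.ext fun φ => ?_)⟩
  refine section_ext fun x => ?_
  have hV := genericPoint_mem x
  exact (G.germAt_evalDual_app s hVU hV φ).trans <|
    (congrArg _ (hs (hVU hV))).trans (he hVU hV φ).symm

end GenericFiber

section Rank
variable {F : X.Modules} {E : Type u} [AddCommGroup E] [Module X.functionField E]

/-- The germ of a section at the generic point. -/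
def genericGerm (F : X.Modules) {V : X.Opens} (hV : genericPoint X ∈ V) (s : F.val.obj (op V)) :
    ↑(TopCat.Presheaf.stalk (C := Ab.{u}) F.presheaf (genericPoint X)) :=
  TopCat.Presheaf.germ (C := Ab.{u}) F.presheaf V (genericPoint X) hV s

lemma genericGerm_res {V W : X.Opens} (h : W ≤ V) (hW : genericPoint X ∈ W)
    (s : F.val.obj (op V)) :
    genericGerm F hW (F.val.restrictₛₗ (homOfLE h).op s) = genericGerm F (h hW) s :=
  TopCat.Presheaf.germ_res_apply (C := Ab.{u}) F.presheaf (homOfLE h) _ _ s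

lemma nonempty_linearEquiv_stalk (G : GenericFiber F.val E) :
    Nonempty (E ≃ₗ[X.presheaf.stalk (genericPoint X)]
      ↑(TopCat.Presheaf.stalk (C := Ab.{u}) F.presheaf (genericPoint X))) := by
  obtain ⟨l, hl⟩ := G.exists_linearMap
    (A := ↑(TopCat.Presheaf.stalk (C := Ab.{u}) F.presheaf (genericPoint X)))
    (U := ⊤) trivial (fun _ hV s => genericGerm F hV s)
    (fun _ hV s t =>
      map_add (TopCat.Presheaf.germ (C := Ab.{u}) F.presheaf _ (genericPoint X) hV).hom s t)
    (fun _ hV a s =>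
      PresheafOfModules.germ_smul (R := X.presheaf) F.val (genericPoint X) _ hV a s)
    (fun _ h hW s => genericGerm_res h hW s)
  refine ⟨LinearEquiv.ofBijective l ⟨fun e f hef => ?_, fun z => ?_⟩⟩
  · obtain ⟨V, hV, s, rfl⟩ := G.exists_val_eq e
    obtain ⟨W, hW, t, rfl⟩ := G.exists_val_eq f
    rw [hl le_top hV s, hl le_top hW t] at hef
    obtain ⟨Z, hZ, i, j, hij⟩ := TopCat.Presheaf.germ_eq (C := Ab.{u}) F.presheaf _ _ _ s t hef
    exact (G.val_res (leOfHom i) hZ s).symm.trans <|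
      (congrArg (G.val hZ) hij).trans (G.val_res (leOfHom j) hZ t)
  · obtain ⟨V, hV, s, rfl⟩ := TopCat.Presheaf.exists_germ_eq (C := Ab.{u}) F.presheaf z
    exact ⟨G.val hV s, hl le_top hV s⟩

lemma rank_eq_finrank (G : GenericFiber F.val E) : rank F = Module.finrank X.functionField E :=
  (nonempty_linearEquiv_stalk G).some.finrank_eq.symm

end Rank
end GenericFiber

section Lattices
variable {R K V : Type*} [CommRing R] [Field K] [Algebra R K] [AddCommGroup V] [Module R V]
  [Module K V] [IsScalarTower R K V]

lemma finite_of_forall_dual [IsNoetherianRing R] [Module.Finite K V] {L : Type*} [AddCommGroup L]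
    [Module R L] (i : L →ₗ[R] V) (hi : Function.Injective i)
    (h : ∀ l : Module.Dual K V, ∃ c : K, c ≠ 0 ∧ ∀ w, c * l (i w) ∈ (1 : Submodule R K)) :
    Module.Finite R L := by
  let b := Module.finBasis K V
  choose c hc hmem using fun j => h (b.coord j)
  let N : Submodule R V := Submodule.span R (Set.range fun j => (c j)⁻¹ • b j)
  have : Module.Finite R N := Module.Finite.span_of_finite _ (Set.finite_range _)
  have hN (w : L) : i w ∈ N := by
    rw [← b.sum_repr (i w)]
    refine sum_mem fun j _ => ?_
    obtain ⟨r, hr⟩ := Submodule.mem_one.1 (hmem j w)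
    have h_coord : b.repr (i w) j • b j = r • (c j)⁻¹ • b j := by
      rw [← algebraMap_smul K r, hr, smul_smul, mul_right_comm, mul_inv_cancel₀ (hc j), one_mul,
        Module.Basis.coord_apply]
    exact h_coord ▸ N.smul_mem r (Submodule.subset_span ⟨j, rfl⟩)
  exact Module.Finite.of_injective (i.codRestrict N hN) fun w w' hw =>
    hi (congrArg Subtype.val hw)

lemma exists_dual_notMem_one [IsDomain R] [IsPrincipalIdealRing R] [IsFractionRing R K]
    (L : Submodule R V) [L.IsLattice K] {v : V} (hv : v ∉ L) :
    ∃ l : Module.Dual K V, (∀ w ∈ L, l w ∈ (1 : Submodule R K)) ∧ l v ∉ (1 : Submodule R K) := by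
  have : Module.Free R L := Submodule.IsLattice.free K L
  let b := Module.Free.chooseBasis R L
  let e := b.extendOfIsLattice K
  have he (j) : e j = b j := b.extendOfIsLattice_apply K j
  have h_repr (w : L) (j) : e.repr w j = algebraMap R K (b.repr w j) := by
    have hw : (w : V) = ∑ j, algebraMap R K (b.repr w j) • e j := by
      conv_lhs => rw [← b.sum_repr w]
      simp only [he, algebraMap_smul, Submodule.coe_sum, Submodule.coe_smul]
    rw [hw, e.repr_sum_self]
  by_contra! h
  refine hv ?_
  rw [← e.sum_repr v]
  refine sum_mem fun j _ => ?_
  obtain ⟨r, hr⟩ := Submodule.mem_one.1 <| h (e.coord j) fun w hw =>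
    Submodule.mem_one.2 ⟨_, (h_repr ⟨w, hw⟩ j).symm⟩
  rw [← e.coord_apply, ← hr, algebraMap_smul, he]
  exact L.smul_mem r (b j).2

end Lattices

section Denominators
variable {X : Scheme.{u}} [IsIntegral X] [IsLocallyNoetherian X]
  [∀ x : X, IsIntegrallyClosed (X.presheaf.stalk x)]

lemma exists_le_ordTop (P : PrimeDivisor X) (m : ℤ) :
    ∃ c : X.functionField, c ≠ 0 ∧ (m : WithTop ℤ) ≤ ordTop P c := by
  obtain ⟨π, hπ⟩ := exists_ordTop_eq_one P
  have hπ0 : π ≠ 0 := ordTop_ne_top.1 (hπ ▸ WithTop.one_ne_top)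
  refine ⟨π ^ m.toNat, pow_ne_zero _ hπ0, ?_⟩
  rw [← ordVal_apply, (ordVal P).map_pow, ordVal_apply, hπ, nsmul_one]
  exact_mod_cast m.self_le_toNat

lemma exists_one_le_ordTop_germAt {U : X.Opens} (hU : IsAffineOpen U) (x : U)
    (P : PrimeDivisor X) (hP : P.1 ∈ U) :
    ∃ a : Γ(X, U), a ≠ 0 ∧ 1 ≤ ordTop P (germAt x a) := by
  have : Nonempty U := ⟨x⟩
  have := functionField_isFractionRing_of_isAffineOpen X U hU
  obtain ⟨π, hπ⟩ := exists_ordTop_eq_one P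
  obtain ⟨a, b, hb, rfl⟩ := IsFractionRing.div_surjective (A := Γ(X, U)) π
  have hb0 : algebraMap Γ(X, U) X.functionField b ≠ 0 :=
    IsFractionRing.to_map_ne_zero_of_mem_nonZeroDivisors hb
  refine ⟨a, fun ha => ?_, ?_⟩
  · rw [ha, map_zero, zero_div, ordTop_zero] at hπ
    exact WithTop.top_ne_one hπ
  · have h_order := ordTop_mul (P := P) (algebraMap Γ(X, U) X.functionField a /
      algebraMap Γ(X, U) X.functionField b) (algebraMap Γ(X, U) X.functionField b)
    rw [div_mul_cancel₀ _ hb0, hπ] at h_order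
    exact h_order ▸ le_add_of_nonneg_right (ordTop_germAt_nonneg x b hP)

lemma exists_forall_le_ordTop {U : X.Opens} (hU : IsAffineOpen U) (x : U) (D : WeilDivisor X) :
    ∃ a : Γ(X, U), a ≠ 0 ∧ ∀ P, P.1 ∈ U → ((D P : ℤ) : WithTop ℤ) ≤ ordTop P (germAt x a) := by
  have : Nonempty U := ⟨x⟩
  induction D using Finsupp.induction_linear with
  | zero => exact ⟨1, one_ne_zero, fun P hP => ordTop_germAt_nonneg x 1 hP⟩
  | add D E hD hE =>
    obtain ⟨a, ha0, ha⟩ := hD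
    obtain ⟨b, hb0, hb⟩ := hE
    refine ⟨a * b, mul_ne_zero ha0 hb0, fun P hP => ?_⟩
    rw [map_mul, ordTop_mul]
    exact add_le_add (ha P hP) (hb P hP)
  | single P n =>
    by_cases hP : P.1 ∈ U
    · obtain ⟨a, ha0, ha⟩ := exists_one_le_ordTop_germAt hU x P hP
      refine ⟨a ^ n.toNat, pow_ne_zero _ ha0, fun Q hQ => ?_⟩
      rcases eq_or_ne P Q with rfl | hPQ
      · rw [Finsupp.single_eq_same, map_pow, ← ordVal_apply, (ordVal P).map_pow]
        refine le_trans ?_ (nsmul_le_nsmul_right ha _)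
        rw [nsmul_one]
        exact_mod_cast n.self_le_toNat
      · rw [Finsupp.single_eq_of_ne' hPQ]
        exact ordTop_germAt_nonneg x _ hQ
    · refine ⟨1, one_ne_zero, fun Q hQ => ?_⟩
      rw [Finsupp.single_eq_of_ne' (by rintro rfl; exact hP hQ)]
      exact ordTop_germAt_nonneg x _ hQ

end Denominators

section BoundedPoles
variable {X : Scheme.{u}} [IsIntegral X] [IsLocallyNoetherian X]

namespace PreWeilDecoration
variable {V : Type u} [AddCommGroup V] [Module X.functionField V] (W : PreWeilDecoration X V)

lemma finite_not_coeff_nonneg (v : V) :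
    {P : PrimeDivisor X | ¬ 0 ≤ coeff (W.toFun v) P}.Finite := by
  cases h : W.toFun v with
  | top => exact Set.finite_empty.subset fun P hP => hP le_top
  | coe D =>
    refine D.support.finite_toSet.subset fun P hP => Finsupp.mem_support_iff.2 fun h0 => hP ?_
    exact WithTop.coe_le_coe.2 h0.ge

lemma exists_neg_le_coeff (v : V) :
    ∃ n : ℕ, ∀ P, ((-n : ℤ) : WithTop ℤ) ≤ coeff (W.toFun v) P := by
  cases h : W.toFun v with
  | top => exact ⟨0, fun _ => le_top⟩
  | coe D =>
    refine ⟨D.support.sup fun P => (D P).natAbs, fun P => WithTop.coe_le_coe.2 ?_⟩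
    change _ ≤ D P
    by_cases hP : P ∈ D.support
    · have := Finset.le_sup (f := fun P => (D P).natAbs) hP
      omega
    · rw [Finsupp.notMem_support_iff.1 hP]
      omega

/-- The section with constant value `v`. -/
def constSection (U : X.Opens) (v : V)
    (h : ∀ P : PrimeDivisor X, P.1 ∈ U → 0 ≤ coeff (W.toFun v) P) : W.sections U :=
  ⟨fun _ => v, fun _ _ => rfl, fun _ P hP => h P hP⟩

/-- The sheaf associated with a pre-Weil decoration of `V`, realized in `V`. -/
def genericFiber : GenericFiber W.sheaf.val V where
  val hU s := (show W.sections _ from s).1 ⟨_, hU⟩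
  val_add _ _ _ := rfl
  val_smul _ _ _ := rfl
  val_res _ _ _ := rfl
  ext {U s t} h := Subtype.ext <| funext fun x =>
    ((show W.sections U from s).2.1 x ⟨_, genericPoint_mem x⟩).trans <|
      (h (genericPoint_mem x)).trans ((show W.sections U from t).2.1 _ x)
  exists_val_eq v := by
    obtain ⟨U, hU, h⟩ := exists_open_forall_notMem (W.finite_not_coeff_nonneg v)
    exact ⟨U, hU, W.constSection U v fun P hP => not_not.1 fun h' => h P h' hP, rfl⟩

/-- Every functional has poles bounded by a fixed Weil divisor on the local sections of the
decoration. -/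
def HasBoundedPoles : Prop :=
  ∀ l : Module.Dual X.functionField V, ∃ D : WeilDivisor X, ∀ v P,
    0 ≤ coeff (W.toFun v) P → ((D P : ℤ) : WithTop ℤ) ≤ ordTop P (l v)

section Normal
variable [∀ x : X, IsIntegrallyClosed (X.presheaf.stalk x)]

variable {W} in
lemma hasBoundedPoles_of_span_eq_top [CompactSpace X] {S : Set (Module.Dual X.functionField V)}
    (hS : Submodule.span X.functionField S = ⊤)
    (h : ∀ l ∈ S, ∃ D : WeilDivisor X, ∀ v P,
      0 ≤ coeff (W.toFun v) P → ((D P : ℤ) : WithTop ℤ) ≤ ordTop P (l v)) :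
    W.HasBoundedPoles := by
  have h_zero : ∃ D : WeilDivisor X, ∀ v P, 0 ≤ coeff (W.toFun v) P →
      ((D P : ℤ) : WithTop ℤ) ≤ ordTop P ((0 : Module.Dual X.functionField V) v) :=
    ⟨0, fun v P _ => by rw [LinearMap.zero_apply, ordTop_zero]; exact le_top⟩
  intro l
  have hl : l ∈ Submodule.span X.functionField S := hS ▸ Submodule.mem_top
  induction hl using Submodule.span_induction with
  | mem l hl => exact h l hl
  | zero => exact h_zero
  | add l l' _ _ hl hl' =>
    obtain ⟨D, hD⟩ := hl
    obtain ⟨D', hD'⟩ := hl'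
    refine ⟨D ⊓ D', fun v P hv => le_trans ?_ ((ordVal P).map_add (l v) (l' v))⟩
    rw [Finsupp.inf_apply]
    exact le_min ((WithTop.coe_le_coe.2 inf_le_left).trans (hD v P hv))
      ((WithTop.coe_le_coe.2 inf_le_right).trans (hD' v P hv))
  | smul c l _ hl =>
    rcases eq_or_ne c 0 with rfl | hc
    · rwa [zero_smul]
    obtain ⟨D, hD⟩ := hl
    have hc_order (P) : ordTop P c = ((Scheme.ord c P.1 : ℤ) : WithTop ℤ) := ordTop_of_ne hc
    have hc_fin : {P : PrimeDivisor X | (Scheme.ord c P.1 : ℤ) ≠ 0}.Finite :=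
      (finite_ordTop_ne_zero hc).subset fun P hP h => hP (by
        rw [hc_order] at h
        exact_mod_cast h)
    let E : WeilDivisor X := Finsupp.onFinset hc_fin.toFinset (fun P => (Scheme.ord c P.1 : ℤ))
      fun P hP => hc_fin.mem_toFinset.2 hP
    refine ⟨E + D, fun v P hv => ?_⟩
    rw [LinearMap.smul_apply, smul_eq_mul, ordTop_mul, hc_order]
    exact add_le_add_right (hD v P hv) _

lemma exists_dualSection {U : X.Opens} (l : Module.Dual X.functionField V)
    (h : ∀ P : PrimeDivisor X, P.1 ∈ U → ∀ v, 0 ≤ coeff (W.toFun v) P → 0 ≤ ordTop P (l v)) :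
    ∃ φ : DualSection W.sheaf.val U, ∀ hU, W.genericFiber.functional hU φ = l := by
  have h_reg (U' : X.Opens) (hU' : U' ≤ U) (s : W.sections U') :
      ∃ a : Γ(X, U'), ∀ x : U', germAt x a = l (s.1 x) := by
    rcases isEmpty_or_nonempty U' with h_empty | ⟨⟨x⟩⟩
    · exact ⟨0, fun x => h_empty.elim x⟩
    · obtain ⟨a, ha⟩ := exists_germAt_eq (l (s.1 x)) U' fun P hP => h P (hU' hP) _ (s.2.2 x P hP)
      exact ⟨a, fun y => by rw [ha, s.2.1 x y]⟩
  choose a ha using h_reg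
  let φ : DualSection W.sheaf.val U :=
    { app U' hU' :=
        { toFun s := a U' hU' s
          map_add' s t := section_ext fun x =>
            (ha U' hU' (show W.sections U' from s + t) x).trans <| (map_add l _ _).trans <| by
              rw [map_add, ← ha U' hU' s x, ← ha U' hU' t x]
          map_smul' c s := section_ext fun x =>
            (ha U' hU' (show W.sections U' from c • s) x).trans <| (map_smul l _ _).trans <| by
              rw [RingHom.id_apply, smul_eq_mul, smul_eq_mul, map_mul, ← ha U' hU' s x] }
      compat U₁ U₂ h₁ h₂ s := section_ext fun x => by
        rw [germAt_map h₂ x]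
        exact (ha U₁ h₁ s _).trans (ha U₂ (h₂.trans h₁) (W.res h₂ s) x).symm }
  exact ⟨φ, fun hU => W.genericFiber.functional_eq hU fun hVU hV s => (ha _ hVU s ⟨_, hV⟩).symm⟩

lemma exists_coeff_smul_nonneg (P : PrimeDivisor X) (v : V) :
    ∃ c : X.functionField, c ≠ 0 ∧ 0 ≤ coeff (W.toFun (c • v)) P := by
  obtain ⟨n, hn⟩ := W.exists_neg_le_coeff v
  obtain ⟨c, hc, hcP⟩ := exists_le_ordTop P n
  refine ⟨c, hc, ?_⟩
  rw [W.smul]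
  refine le_trans ?_ (add_le_add hcP (hn P))
  rw [← WithTop.coe_add, add_neg_cancel, WithTop.coe_zero]

variable {W} (hW : W.HasBoundedPoles)

include hW

lemma HasBoundedPoles.exists_functional_eq (l : Module.Dual X.functionField V) :
    ∃ (U : X.Opens) (hU : genericPoint X ∈ U) (φ : DualSection W.sheaf.val U),
      W.genericFiber.functional hU φ = l := by
  obtain ⟨D, hD⟩ := hW l
  obtain ⟨U, hU, h⟩ := exists_open_forall_notMem D.support.finite_toSet
  obtain ⟨φ, hφ⟩ := W.exists_dualSection (U := U) l fun P hP v hv => by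
    have hDP := hD v P hv
    rwa [Finsupp.notMem_support_iff.1 fun hPD => h P hPD hP] at hDP
  exact ⟨U, hU, φ, hφ hU⟩

lemma HasBoundedPoles.exists_forall_ordTop_mul_nonneg (P : PrimeDivisor X)
    (l : Module.Dual X.functionField V) :
    ∃ c : X.functionField, c ≠ 0 ∧ ∀ v, 0 ≤ coeff (W.toFun v) P → 0 ≤ ordTop P (c * l v) := by
  obtain ⟨D, hD⟩ := hW l
  obtain ⟨c, hc, hcP⟩ := exists_le_ordTop P (-D P)
  refine ⟨c, hc, fun v hv => ?_⟩
  rw [ordTop_mul]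
  refine le_trans ?_ (add_le_add hcP (hD v P hv))
  rw [← WithTop.coe_add, neg_add_cancel, WithTop.coe_zero]

lemma HasBoundedPoles.exists_dual_ordTop_neg [Module.Finite X.functionField V]
    {P : PrimeDivisor X} {v : V} (hv : ¬ 0 ≤ coeff (W.toFun v) P) :
    ∃ l : Module.Dual X.functionField V,
      (∀ w, 0 ≤ coeff (W.toFun w) P → 0 ≤ ordTop P (l w)) ∧ ¬ 0 ≤ ordTop P (l v) := by
  let := Module.compHom V (algebraMap (X.presheaf.stalk P.1) X.functionField)
  have : IsScalarTower (X.presheaf.stalk P.1) X.functionField V :=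
    IsScalarTower.of_algebraMap_smul fun _ _ => rfl
  have h_one (f : X.functionField) :
      f ∈ (1 : Submodule (X.presheaf.stalk P.1) X.functionField) ↔ 0 ≤ ordTop P f :=
    Submodule.mem_one.trans ordTop_nonneg_iff.symm
  let L : Submodule (X.presheaf.stalk P.1) V :=
    { carrier := {w | 0 ≤ coeff (W.toFun w) P}
      zero_mem' := (W.coeff_zero P).ge.trans' le_top
      add_mem' hw hw' := (le_inf hw hw').trans (coeff_inf_le (W.inf_le_add _ _) P)
      smul_mem' a w hw := (add_nonneg (ordTop_algebraMap_nonneg P a) hw).trans_eq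
        (W.smul _ w P).symm }
  have : L.IsLattice X.functionField := by
    refine ⟨Module.Finite.iff_fg.1 (finite_of_forall_dual (K := X.functionField) L.subtype
      L.subtype_injective fun l => ?_), _root_.eq_top_iff.2 fun w _ => ?_⟩
    · obtain ⟨c, hc, hcl⟩ := hW.exists_forall_ordTop_mul_nonneg P l
      exact ⟨c, hc, fun w => (h_one _).2 (hcl w w.2)⟩
    · obtain ⟨c, hc, hcw⟩ := W.exists_coeff_smul_nonneg P w
      rw [← inv_smul_smul₀ hc w]
      exact Submodule.smul_mem _ _ (Submodule.subset_span hcw)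
  obtain ⟨l, hl, hlv⟩ := exists_dual_notMem_one (K := X.functionField) L hv
  exact ⟨l, fun w hw => (h_one _).1 (hl w hw), fun h => hlv ((h_one _).2 h)⟩

lemma HasBoundedPoles.bijective_evalDual [Module.Finite X.functionField V] (U : X.Opens) :
    Function.Bijective (evalDual (P := W.sheaf.val) U) := by
  refine W.genericFiber.bijective_evalDual hW.exists_functional_eq U fun v hv => ?_
  refine ⟨W.constSection U v fun P hP => ?_, fun _ => rfl⟩
  by_contra hvP
  obtain ⟨l, hl, hlv⟩ := hW.exists_dual_ordTop_neg hvP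
  obtain ⟨D, hD⟩ := hW l
  obtain ⟨O, hPO, hO⟩ := exists_open_avoiding P D.support.finite_toSet
  obtain ⟨φ, hφ⟩ := W.exists_dualSection (U := U ⊓ O) l fun Q hQ w hw => by
    by_cases hQD : Q ∈ D.support
    · obtain rfl := hO Q hQ.2 hQD
      exact hl w hw
    · have hDQ := hD w Q hw
      rwa [Finsupp.notMem_support_iff.1 hQD] at hDQ
  have hP' : P.1 ∈ U ⊓ O := ⟨hP, hPO⟩
  have hη := genericPoint_mem ⟨P.1, hP'⟩
  obtain ⟨a, ha⟩ := hv inf_le_left hη φ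
  rw [hφ] at ha
  exact hlv (ha ▸ ordTop_germAt_nonneg _ a hP')

end Normal
end PreWeilDecoration
end BoundedPoles

section Coherence
variable {X : Scheme.{u}} [IsIntegral X]

lemma germAt_fromSpec {U : X.Opens} (hU : IsAffineOpen U) (O : (Spec Γ(X, U)).Opens)
    (x : (hU.fromSpec ''ᵁ O : X.Opens)) (y : U) (r : Γ(X, U)) :
    (germAt x ((hU.fromSpec.appIso O).inv ((Spec Γ(X, U)).presheaf.map O.leTop.op
      ((Scheme.ΓSpecIso Γ(X, U)).inv r))) : X.functionField) = germAt y r := by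
  have hOU : hU.fromSpec ''ᵁ O ≤ U :=
    (hU.fromSpec.image_mono le_top).trans (fromSpec_image_top hU).le
  have hOU' : O ≤ hU.fromSpec ⁻¹ᵁ U := hU.fromSpec_preimage_self ▸ le_top
  have h_app : hU.fromSpec.appLE U O hOU' r = (Spec Γ(X, U)).presheaf.map O.leTop.op
      ((Scheme.ΓSpecIso Γ(X, U)).inv r) := by
    rw [Scheme.Hom.appLE, hU.fromSpec_app_self, Category.assoc, ← Functor.map_comp]
    rfl
  rw [← h_app, Scheme.Hom.appLE_appIso_inv_apply hU.fromSpec hOU' r]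
  exact germAt_map hOU x r

variable [IsLocallyNoetherian X]

namespace PreWeilDecoration
variable {V : Type u} [AddCommGroup V] [Module X.functionField V] (W : PreWeilDecoration X V)

/-- A section, over an open subset of `Spec Γ(X, U)`, of the sheaf associated with a decoration,
as a section over the corresponding open subset of `U`. -/
def ofSpecSection {U : X.Opens} (hU : IsAffineOpen U) {O : (Spec Γ(X, U)).Opens}
    (s : (modulesSpecToSheaf.obj (W.sheaf.restrict hU.fromSpec)).obj.obj (op O)) :
    W.sections (hU.fromSpec ''ᵁ O) := s

lemma ofSpecSection_smul {U : X.Opens} (hU : IsAffineOpen U) {O : (Spec Γ(X, U)).Opens}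
    (r : Γ(X, U)) (s : (modulesSpecToSheaf.obj (W.sheaf.restrict hU.fromSpec)).obj.obj (op O))
    (x : (hU.fromSpec ''ᵁ O : X.Opens)) (y : U) :
    (W.ofSpecSection hU (r • s)).1 x =
      (germAt y r : X.functionField) • (W.ofSpecSection hU s).1 x :=
  congrArg (· • (W.ofSpecSection hU s).1 x) (germAt_fromSpec hU O x y r)

section Normal
variable [∀ x : X, IsIntegrallyClosed (X.presheaf.stalk x)]

lemma exists_pow_smul_nonneg {U : X.Opens} (x : U) (f : Γ(X, U)) (v : V)
    (hv : ∀ P : PrimeDivisor X, P.1 ∈ X.basicOpen f → 0 ≤ coeff (W.toFun v) P) :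
    ∃ n : ℕ, ∀ P : PrimeDivisor X, P.1 ∈ U →
      0 ≤ coeff (W.toFun ((germAt x (f ^ n) : X.functionField) • v)) P := by
  obtain ⟨n, hn⟩ := W.exists_neg_le_coeff v
  refine ⟨n, fun P hP => ?_⟩
  rw [W.smul]
  by_cases hPf : P.1 ∈ X.basicOpen f
  · exact add_nonneg (ordTop_germAt_nonneg x _ hP) (hv P hPf)
  · have h_one : 1 ≤ ordTop P (germAt x f) := by
      rw [germAt_eq_algebraMap x hP, one_le_ordTop_algebraMap_iff]
      rw [Scheme.mem_basicOpen X f P.1 hP] at hPf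
      exact (IsLocalRing.residue_eq_zero_iff _).2 hPf
    have h_pow : ((n : ℤ) : WithTop ℤ) ≤ ordTop P (germAt x (f ^ n)) := by
      rw [map_pow, ← ordVal_apply, (ordVal P).map_pow]
      refine le_trans ?_ (nsmul_le_nsmul_right h_one n)
      rw [nsmul_one]
      rfl
    refine le_trans ?_ (add_le_add h_pow (hn P))
    rw [← WithTop.coe_add, add_neg_cancel, WithTop.coe_zero]

lemma isLocalizing_sheaf {U : X.Opens} (hU : IsAffineOpen U) (x : U) :
    IsLocalizing (modulesSpecToSheaf.obj (W.sheaf.restrict hU.fromSpec)) := by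
  intro f
  have hf : hU.fromSpec ''ᵁ PrimeSpectrum.basicOpen f = X.basicOpen f :=
    hU.fromSpec_image_basicOpen f
  refine IsLocalizedModule.Away.mk_of_addCommGroup
    (Scheme.Modules.isUnit_algebraMap_end_of_le_basicOpen
      (M := W.sheaf.restrict hU.fromSpec) f le_rfl) (fun s => ?_) (fun s hs => ?_)
  · rcases isEmpty_or_nonempty ↥(hU.fromSpec ''ᵁ PrimeSpectrum.basicOpen f) with
      h_empty | ⟨⟨z⟩⟩
    · exact ⟨0, 0, Subtype.ext (funext h_empty.elim)⟩
    · let s' := W.ofSpecSection hU s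
      obtain ⟨n, hn⟩ := W.exists_pow_smul_nonneg x f (s'.1 z)
        fun P hP => s'.2.2 z P (hf.ge hP)
      refine ⟨n, W.constSection (hU.fromSpec ''ᵁ ⊤) _
        fun P hP => hn P ((fromSpec_image_top hU).le hP), Subtype.ext (funext fun y => ?_)⟩
      exact (W.ofSpecSection_smul hU (f ^ n) s y x).trans (congrArg _ (s'.2.1 y z))
  · rcases isEmpty_or_nonempty ↥(hU.fromSpec ''ᵁ PrimeSpectrum.basicOpen f) with
      h_empty | ⟨⟨z⟩⟩
    · have hf0 : f = 0 := (basicOpen_eq_bot_iff f).1 <| hf.symm.trans <|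
        Opens.ext (Set.isEmpty_coe_sort.1 h_empty)
      refine ⟨1, ?_⟩
      rw [hf0, pow_one, zero_smul]
    · refine ⟨0, ?_⟩
      rw [pow_zero, one_smul]
      have h_zero : (W.ofSpecSection hU s).1 ⟨z, hU.fromSpec.image_mono le_top z.2⟩ = 0 :=
        congrFun (congrArg Subtype.val hs) z
      exact Subtype.ext (funext fun y => ((W.ofSpecSection hU s).2.1 y _).trans h_zero)

variable {W} (hW : W.HasBoundedPoles) [Module.Finite X.functionField V]

include hW

lemma HasBoundedPoles.finite_sections {U : X.Opens} (hU : IsAffineOpen U) (x : U) :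
    Module.Finite Γ(X, U)
      ((modulesSpecToSheaf.obj (W.sheaf.restrict hU.fromSpec)).obj.obj (op ⊤)) := by
  have : Nonempty U := ⟨x⟩
  have : IsNoetherianRing Γ(X, U) := IsLocallyNoetherian.component_noetherian ⟨U, hU⟩
  let z : (hU.fromSpec ''ᵁ ⊤ : X.Opens) := ⟨x.1, (fromSpec_image_top hU).ge x.2⟩
  let := Module.compHom V (germAt x : Γ(X, U) →+* X.functionField)
  have : IsScalarTower Γ(X, U) X.functionField V :=
    IsScalarTower.of_algebraMap_smul fun _ _ => rfl
  let i : ((modulesSpecToSheaf.obj (W.sheaf.restrict hU.fromSpec)).obj.obj (op ⊤)) →ₗ[Γ(X, U)] V :=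
    { toFun s := (W.ofSpecSection hU s).1 z
      map_add' _ _ := rfl
      map_smul' r s := W.ofSpecSection_smul hU r s z x }
  have hi : Function.Injective i := fun s t hst => Subtype.ext <| funext fun y =>
    ((W.ofSpecSection hU s).2.1 y z).trans <| hst.trans ((W.ofSpecSection hU t).2.1 z y)
  refine finite_of_forall_dual (K := X.functionField) i hi fun l => ?_
  obtain ⟨D, hD⟩ := hW l
  obtain ⟨a, ha0, ha⟩ := exists_forall_le_ordTop hU x (-D)
  refine ⟨germAt x a, fun h => ha0 (germAt_injective x (h.trans (map_zero _).symm)),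
    fun s => Submodule.mem_one.2 ?_⟩
  obtain ⟨r, hr⟩ := exists_germAt_eq (germAt x a * l (i s)) U fun P hP => by
    rw [ordTop_mul]
    refine le_trans ?_ (add_le_add (ha P hP)
      (hD _ P ((W.ofSpecSection hU s).2.2 z P ((fromSpec_image_top hU).ge hP))))
    rw [Finsupp.neg_apply, ← WithTop.coe_add, neg_add_cancel, WithTop.coe_zero]
  exact ⟨r, hr x⟩

lemma HasBoundedPoles.isWeilDecoration : W.IsWeilDecoration := by
  intro x
  obtain ⟨U, hU, hxU, -⟩ := exists_isAffineOpen_mem_and_subset (U := ⊤) (x := x) trivial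
  have := hW.finite_sections hU ⟨x, hxU⟩
  have := (isIso_fromTildeΓ_iff_isLocalizing _).2 (W.isLocalizing_sheaf hU ⟨x, hxU⟩)
  exact ⟨U, hU, hxU, _, inferInstance,
    ⟨(asIso (Scheme.Modules.fromTildeΓ (W.sheaf.restrict hU.fromSpec))).symm⟩⟩

lemma HasBoundedPoles.isReflexive_sheaf : IsReflexive W.sheaf :=
  ⟨hW.isWeilDecoration, hW.bijective_evalDual⟩

end Normal
end PreWeilDecoration
end Coherence

section Value
variable {X : Scheme.{u}} [IsIntegral X] {P : PrimeDivisor X}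

lemma value_eq_coe_iff {f : X.functionField} {c : X.residueField P.1} :
    value P f = c ↔ ∃ a : X.presheaf.stalk P.1,
      algebraMap _ X.functionField a = f ∧ X.residue P.1 a = c := by
  unfold value
  split_ifs with h
  · rw [WithTop.coe_inj]
    refine ⟨fun hc => ⟨h.choose, h.choose_spec, hc⟩, ?_⟩
    rintro ⟨a, ha, rfl⟩
    rw [IsFractionRing.injective (X.presheaf.stalk P.1) X.functionField
      (h.choose_spec.trans ha.symm)]
  · exact iff_of_false WithTop.top_ne_coe fun ⟨a, ha, _⟩ => h ⟨a, ha⟩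

lemma value_algebraMap (a : X.presheaf.stalk P.1) :
    value P (algebraMap _ X.functionField a) = (X.residue P.1 a : X.residueField P.1) :=
  value_eq_coe_iff.2 ⟨a, rfl, rfl⟩

lemma value_eq_value_algebraMap_iff [IsLocallyNoetherian X]
    [∀ x : X, IsIntegrallyClosed (X.presheaf.stalk x)] {f : X.functionField}
    {a : X.presheaf.stalk P.1} :
    value P f = value P (algebraMap _ X.functionField a) ↔
      1 ≤ ordTop P (f - algebraMap _ X.functionField a) := by
  rw [value_algebraMap, value_eq_coe_iff]
  constructor
  · rintro ⟨b, rfl, hb⟩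
    rw [← map_sub, one_le_ordTop_algebraMap_iff, map_sub, hb, sub_self]
  · intro h
    obtain ⟨b, hb⟩ := ordTop_nonneg_iff.1 (zero_le_one.trans h)
    rw [← hb, one_le_ordTop_algebraMap_iff] at h
    refine ⟨b + a, by rw [map_add, hb, sub_add_cancel], ?_⟩
    rw [map_add, h, zero_add]

end Value

section TwistedOrder
variable {X : Scheme.{u}} [IsIntegral X] [IsLocallyNoetherian X]

lemma le_of_lt_add_one {m n : WithTop ℤ} (h : m < n + 1) : m ≤ n := by
  cases n with
  | top => exact le_top
  | coe n => cases m with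
    | top => exact absurd h not_top_lt
    | coe m => exact WithTop.coe_le_coe.2 (Int.le_of_lt_add_one (WithTop.coe_lt_coe.1 h))

/-- The order along `P` on `K²` for which `(t, 1)` and `(1, 0)` form an orthogonal basis, of orders
`n` and `0`. -/
def twistedOrd (P : PrimeDivisor X) (t : X.functionField) (n : ℤ)
    (v : X.functionField × X.functionField) : WithTop ℤ :=
  min (ordTop P (v.1 - t * v.2)) (ordTop P v.2 + n)

variable {P : PrimeDivisor X} {t : X.functionField} {n : ℤ}

lemma neg_le_ordTop_snd_of_twistedOrd_nonneg {v : X.functionField × X.functionField}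
    (hv : 0 ≤ twistedOrd P t n v) : ((-n : ℤ) : WithTop ℤ) ≤ ordTop P v.2 := by
  have h := add_le_add_left (hv.trans (min_le_right _ _)) ((-n : ℤ) : WithTop ℤ)
  rwa [zero_add, add_assoc, ← WithTop.coe_add, add_neg_cancel, WithTop.coe_zero, add_zero] at h

variable [∀ x : X, IsIntegrallyClosed (X.presheaf.stalk x)]

lemma twistedOrd_eq_top_iff {v : X.functionField × X.functionField} :
    twistedOrd P t n v = ⊤ ↔ v = 0 := by
  rw [twistedOrd, min_eq_top, WithTop.add_coe_eq_top_iff, ← ordVal_apply, ← ordVal_apply,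
    (ordVal P).top_iff, (ordVal P).top_iff, Prod.ext_iff]
  refine and_congr_left fun h => ?_
  rw [h, mul_zero, sub_zero, Prod.fst_zero]

lemma twistedOrd_smul (c : X.functionField) (v : X.functionField × X.functionField) :
    twistedOrd P t n (c • v) = ordTop P c + twistedOrd P t n v := by
  simp only [twistedOrd, Prod.smul_fst, Prod.smul_snd, smul_eq_mul]
  rw [mul_left_comm, ← mul_sub, ordTop_mul, ordTop_mul, add_assoc, min_add_add_left]

lemma min_twistedOrd_le_add (v w : X.functionField × X.functionField) :
    min (twistedOrd P t n v) (twistedOrd P t n w) ≤ twistedOrd P t n (v + w) := by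
  have h_fst : (v + w).1 - t * (v + w).2 = v.1 - t * v.2 + (w.1 - t * w.2) := by
    rw [Prod.fst_add, Prod.snd_add, mul_add, add_sub_add_comm]
  refine le_min ?_ ?_
  · rw [h_fst]
    exact (min_le_min (min_le_left _ _) (min_le_left _ _)).trans ((ordVal P).map_add _ _)
  · refine (min_le_min (min_le_right _ _) (min_le_right _ _)).trans ?_
    rw [min_add_add_right]
    exact add_le_add_left ((ordVal P).map_add v.2 w.2) _

lemma min_ordTop_sub_mul (ht : 0 ≤ ordTop P t) (f g : X.functionField) :
    min (ordTop P (f - t * g)) (ordTop P g) = min (ordTop P f) (ordTop P g) := by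
  have h_mul : ordTop P g ≤ ordTop P (t * g) := by
    rw [ordTop_mul]; exact le_add_of_nonneg_left ht
  have h_sub := (ordVal P).map_sub f (t * g)
  have h_add := (ordVal P).map_add (f - t * g) (t * g)
  rw [sub_add_cancel] at h_add
  exact le_antisymm
    (le_min ((min_le_min_left _ h_mul).trans h_add) (min_le_right _ _))
    (le_min ((min_le_min_left _ h_mul).trans h_sub) (min_le_right _ _))

lemma twistedOrd_zero (ht : 0 ≤ ordTop P t) (f g : X.functionField) :
    twistedOrd P t 0 (f, g) = min (ordTop P f) (ordTop P g) := by
  rw [twistedOrd, WithTop.coe_zero, add_zero, min_ordTop_sub_mul ht]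

lemma one_le_ordTop_div_sub_iff {f g : X.functionField} (hg : g ≠ 0) :
    1 ≤ ordTop P (f / g - t) ↔ ordTop P g + 1 ≤ ordTop P (f - t * g) := by
  have h : f - t * g = g * (f / g - t) := by rw [mul_sub, mul_div_cancel₀ _ hg, mul_comm t]
  rw [h, ordTop_mul, WithTop.add_le_add_iff_left (ordTop_ne_top.2 hg)]

lemma twistedOrd_one_of_le (ht : 0 ≤ ordTop P t) {f g : X.functionField} (hg : g ≠ 0)
    (h : 1 ≤ ordTop P (f / g - t)) :
    twistedOrd P t 1 (f, g) = min (ordTop P f) (ordTop P g) + 1 := by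
  rw [one_le_ordTop_div_sub_iff hg] at h
  rw [← min_ordTop_sub_mul ht, twistedOrd, WithTop.coe_one, min_eq_right h,
    min_eq_right ((le_add_of_nonneg_right zero_le_one).trans h)]

lemma twistedOrd_one_of_not_le (ht : 0 ≤ ordTop P t) {f g : X.functionField}
    (h : ¬ (g ≠ 0 ∧ 1 ≤ ordTop P (f / g - t))) :
    twistedOrd P t 1 (f, g) = min (ordTop P f) (ordTop P g) := by
  rw [← min_ordTop_sub_mul ht, twistedOrd, WithTop.coe_one]
  rcases eq_or_ne g 0 with rfl | hg
  · rw [ordTop_zero, top_add]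
  have h_lt : ordTop P (f - t * g) < ordTop P g + 1 :=
    not_le.1 fun h' => h ⟨hg, (one_le_ordTop_div_sub_iff hg).2 h'⟩
  rw [min_eq_left h_lt.le, min_eq_left (le_of_lt_add_one h_lt)]

lemma neg_le_ordTop_fst_of_twistedOrd_nonneg (ht : 0 ≤ ordTop P t) (hn : 0 ≤ n)
    {v : X.functionField × X.functionField}
    (hv : 0 ≤ twistedOrd P t n v) : ((-n : ℤ) : WithTop ℤ) ≤ ordTop P v.1 := by
  have h_snd := neg_le_ordTop_snd_of_twistedOrd_nonneg hv
  have h_fst : ((-n : ℤ) : WithTop ℤ) ≤ ordTop P (v.1 - t * v.2) :=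
    (WithTop.coe_le_coe.2 (neg_nonpos.2 hn)).trans (hv.trans (min_le_left _ _))
  exact (le_min h_fst h_snd).trans ((min_ordTop_sub_mul ht _ _).trans_le (min_le_left _ _))

end TwistedOrder

section Twist
variable {X : Scheme.{u}} [IsIntegral X] [IsLocallyNoetherian X]

lemma PreWeilDecoration.exists_coeff_eq {V : Type u} [AddCommGroup V] [Module X.functionField V]
    (ord : PrimeDivisor X → V → WithTop ℤ) (h_top : ∀ P v, ord P v = ⊤ ↔ v = 0)
    (h_fin : ∀ v ≠ 0, {P | ord P v ≠ 0}.Finite)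
    (h_smul : ∀ P (f : X.functionField) v, ord P (f • v) = ordTop P f + ord P v)
    (h_add : ∀ P v w, min (ord P v) (ord P w) ≤ ord P (v + w)) :
    ∃ W : PreWeilDecoration X V, ∀ v P, coeff (W.toFun v) P = ord P v := by
  have h_div (v : V) : ∃ D : WithTop (WeilDivisor X), (D = ⊤ ↔ v = 0) ∧
      ∀ P, coeff D P = ord P v := by
    rcases eq_or_ne v 0 with rfl | hv
    · exact ⟨⊤, iff_of_true rfl rfl, fun P => ((h_top P 0).2 rfl).symm⟩
    · choose n hn using fun P => WithTop.ne_top_iff_exists.1 ((h_top P v).not.2 hv)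
      refine ⟨(Finsupp.ofSupportFinite n ((h_fin v hv).subset fun P hP h => hP ?_) :
        WeilDivisor X), iff_of_false WithTop.coe_ne_top hv, hn⟩
      rw [← hn] at h
      exact_mod_cast h
  choose D hD_top hD using h_div
  refine ⟨⟨D, hD_top, fun f v P => by rw [hD, hD, h_smul], fun v w => ?_⟩, fun v P => hD v P⟩
  have h_le (P) : min (coeff (D v) P) (coeff (D w) P) ≤ coeff (D (v + w)) P := by
    rw [hD, hD, hD]
    exact h_add P v w
  cases hv : D v with
  | top => rw [(hD_top v).1 hv, zero_add, top_inf_eq]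
  | coe E => cases hw : D w with
    | top => rw [(hD_top w).1 hw, add_zero, hv, inf_top_eq]
    | coe E' => cases hvw : D (v + w) with
      | top => exact le_top
      | coe F =>
        rw [hv, hw, hvw] at h_le
        rw [← WithTop.coe_inf, WithTop.coe_le_coe]
        exact fun P => WithTop.coe_le_coe.1 (h_le P)

variable [∀ x : X, IsIntegrallyClosed (X.presheaf.stalk x)]

lemma finite_min_ordTop_ne_zero [CompactSpace X] {f g : X.functionField} (h : (f, g) ≠ 0) :
    {P : PrimeDivisor X | min (ordTop P f) (ordTop P g) ≠ 0}.Finite := by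
  rcases eq_or_ne f 0 with rfl | hf
  · have hg : g ≠ 0 := fun hg => h (Prod.ext rfl hg)
    simpa only [ordTop_zero, min_eq_right le_top] using finite_ordTop_ne_zero hg
  rcases eq_or_ne g 0 with rfl | hg
  · simpa only [ordTop_zero, min_eq_left le_top] using finite_ordTop_ne_zero hf
  refine ((finite_ordTop_ne_zero hf).union (finite_ordTop_ne_zero hg)).subset fun P hP => ?_
  by_contra h_zero
  obtain ⟨hfP, hgP⟩ := not_or.1 h_zero
  exact hP (by rw [not_not.1 hfP, not_not.1 hgP, min_self])

lemma exists_coeff_eq_twistedOrd [CompactSpace X] (t : PrimeDivisor X →₀ X.functionField)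
    (E : WeilDivisor X) :
    ∃ W : PreWeilDecoration X (X.functionField × X.functionField),
      ∀ v P, coeff (W.toFun v) P = twistedOrd P (t P) (E P) v := by
  refine PreWeilDecoration.exists_coeff_eq _ (fun _ _ => twistedOrd_eq_top_iff) (fun v hv => ?_)
    (fun _ => twistedOrd_smul) fun _ => min_twistedOrd_le_add
  refine ((t.hasFiniteSupport.union E.hasFiniteSupport).union (finite_min_ordTop_ne_zero hv)).subset
    fun P hP => or_iff_not_imp_left.2 fun h => ?_
  obtain ⟨ht, hE⟩ := not_or.1 h
  rw [Function.notMem_support] at ht hE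
  rwa [Set.mem_ofPred_eq, ht, hE, twistedOrd_zero (le_top.trans_eq ordTop_zero.symm)] at hP

lemma span_fst_snd (K : Type*) [Field K] :
    Submodule.span K {LinearMap.fst K K K, LinearMap.snd K K K} = ⊤ := by
  rw [_root_.eq_top_iff]
  intro l _
  rw [Submodule.mem_span_pair]
  refine ⟨l (1, 0), l (0, 1), LinearMap.prod_ext ?_ ?_⟩
  all_goals ext; simp

lemma hasBoundedPoles_of_coeff_eq_twistedOrd [CompactSpace X]
    {t : PrimeDivisor X → X.functionField} (ht : ∀ P, 0 ≤ ordTop P (t P))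
    {E : WeilDivisor X} (hE : 0 ≤ E)
    {W : PreWeilDecoration X (X.functionField × X.functionField)}
    (hW : ∀ v P, coeff (W.toFun v) P = twistedOrd P (t P) (E P) v) : W.HasBoundedPoles := by
  refine PreWeilDecoration.hasBoundedPoles_of_span_eq_top (span_fst_snd X.functionField) ?_
  rintro l (rfl | rfl) <;> refine ⟨-E, fun v P hv => ?_⟩ <;> rw [hW] at hv
  · exact neg_le_ordTop_fst_of_twistedOrd_nonneg (ht P) (hE P) hv
  · exact neg_le_ordTop_snd_of_twistedOrd_nonneg hv

/-- The coefficients of the decoration of `K²` which jumps along `D i` where the slope `f / g` takes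
the value `c i`. -/
def IsJumpDecoration {ι : Type*} (W : PreWeilDecoration X (X.functionField × X.functionField))
    (D : ι → PrimeDivisor X) (c : ∀ i, WithTop (X.residueField (D i).1)) : Prop :=
  ∀ (f g : X.functionField) (P : PrimeDivisor X),
    ((∃ i, P = D i ∧ g ≠ 0 ∧ value (D i) (f / g) = c i) →
      coeff (W.toFun (f, g)) P = min (ordTop P f) (ordTop P g) + 1) ∧
    ((¬ ∃ i, P = D i ∧ g ≠ 0 ∧ value (D i) (f / g) = c i) →
      coeff (W.toFun (f, g)) P = min (ordTop P f) (ordTop P g))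

lemma isJumpDecoration_of_coeff_eq {ι : Type*} {D : ι → PrimeDivisor X}
    (hD : Function.Injective D) (t : ∀ i, X.presheaf.stalk (D i).1)
    {W : PreWeilDecoration X (X.functionField × X.functionField)}
    (h_one : ∀ i v, coeff (W.toFun v) (D i) = twistedOrd (D i) (algebraMap _ _ (t i)) 1 v)
    (h_zero : ∀ P ∉ Set.range D, ∀ v, coeff (W.toFun v) P = twistedOrd P 0 0 v) :
    IsJumpDecoration W D fun i => value (D i) (algebraMap _ _ (t i)) := by
  intro f g P
  by_cases hP : P ∈ Set.range D
  · obtain ⟨i, rfl⟩ := hP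
    have ht := ordTop_algebraMap_nonneg (D i) (t i)
    have h_iff : (∃ j, D i = D j ∧ g ≠ 0 ∧ value (D j) (f / g) =
        value (D j) (algebraMap _ _ (t j))) ↔
        g ≠ 0 ∧ 1 ≤ ordTop (D i) (f / g - algebraMap _ _ (t i)) := by
      rw [← value_eq_value_algebraMap_iff]
      refine ⟨fun ⟨j, hj, h⟩ => ?_, fun h => ⟨i, rfl, h⟩⟩
      obtain rfl := hD hj
      exact h
    rw [h_iff, h_one]
    exact ⟨fun h => twistedOrd_one_of_le ht h.1 h.2, twistedOrd_one_of_not_le ht⟩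
  · refine ⟨fun ⟨i, hi, _⟩ => absurd ⟨i, hi.symm⟩ hP, fun _ => ?_⟩
    rw [h_zero P hP, twistedOrd_zero (le_top.trans_eq ordTop_zero.symm)]

theorem exists_isJumpDecoration [CompactSpace X] {ι : Type*} [Finite ι]
    {D : ι → PrimeDivisor X} (hD : Function.Injective D) (c : ∀ i, X.residueField (D i).1) :
    ∃ W : PreWeilDecoration X (X.functionField × X.functionField),
      IsJumpDecoration W D (fun i => c i) ∧
      W.IsWeilDecoration ∧ IsReflexive W.sheaf ∧ rank W.sheaf = 2 := by
  choose a ha using fun i => X.residue_surjective (D i).1 (c i)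
  obtain rfl : (fun i => X.residue (D i).1 (a i)) = c := funext ha
  let t : PrimeDivisor X →₀ X.functionField :=
    Finsupp.mapDomain D (Finsupp.equivFunOnFinite.symm fun i => algebraMap _ _ (a i))
  let E : WeilDivisor X := Finsupp.mapDomain D (Finsupp.equivFunOnFinite.symm fun _ => 1)
  have ht (i) : t (D i) = algebraMap _ _ (a i) := Finsupp.mapDomain_apply hD _ i
  have hE (i) : E (D i) = 1 := Finsupp.mapDomain_apply hD _ i
  have ht_zero (P) (hP : P ∉ Set.range D) : t P = 0 := Finsupp.mapDomain_of_notMem_range _ _ hP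
  have hE_zero (P) (hP : P ∉ Set.range D) : E P = 0 := Finsupp.mapDomain_of_notMem_range _ _ hP
  have ht_nonneg (P) : 0 ≤ ordTop P (t P) := by
    by_cases hP : P ∈ Set.range D
    · obtain ⟨i, rfl⟩ := hP
      exact ht i ▸ ordTop_algebraMap_nonneg _ _
    · exact (ht_zero P hP ▸ ordTop_zero).ge.trans' le_top
  have hE_nonneg : 0 ≤ E := fun P => by
    by_cases hP : P ∈ Set.range D
    · obtain ⟨i, rfl⟩ := hP
      exact (hE i).ge.trans' zero_le_one
    · exact (hE_zero P hP).ge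
  obtain ⟨W, hW⟩ := exists_coeff_eq_twistedOrd t E
  have hW_poles := hasBoundedPoles_of_coeff_eq_twistedOrd ht_nonneg hE_nonneg hW
  refine ⟨W, ?_, hW_poles.isWeilDecoration, hW_poles.isReflexive_sheaf,
    (rank_eq_finrank W.genericFiber).trans (by simp)⟩
  simp only [← value_algebraMap]
  exact isJumpDecoration_of_coeff_eq hD a (fun i v => by rw [hW, ht, hE])
    fun P hP v => by rw [hW, ht_zero P hP, hE_zero P hP]

end Twist

section MonoidAlgebra
open scoped LaurentPolynomial

lemma isIntegrallyClosedIn_of_isLocalization {A : Type*} (B : Type*) [CommRing A] [IsDomain A]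
    [IsIntegrallyClosed A] [CommRing B] [Algebra A B] {S : Submonoid A} (hS : S ≤ nonZeroDivisors A)
    [IsLocalization S B] : IsIntegrallyClosedIn A B := by
  refine AlgHom.isIntegrallyClosedIn
    (Localization.mapToFractionRing (FractionRing A) S B hS) ?_ ‹_›
  refine (IsLocalization.lift_injective_iff _).2 fun a b => ?_
  exact ⟨fun h => congrArg _ (IsLocalization.injective _ hS h),
    fun h => congrArg _ (IsFractionRing.injective A (FractionRing A) h)⟩

variable (A : Type*) [CommRing A]

lemma powers_X_le_nonZeroDivisors [IsDomain A] :
    Submonoid.powers (Polynomial.X : Polynomial A) ≤ nonZeroDivisors (Polynomial A) :=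
  powers_le_nonZeroDivisors_of_noZeroDivisors Polynomial.X_ne_zero

instance isIntegrallyClosed_laurentPolynomial [IsDomain A] [IsIntegrallyClosed A] :
    IsIntegrallyClosed A[T;T⁻¹] :=
  isIntegrallyClosed_of_isLocalization (R := Polynomial A) _
    (Submonoid.powers (Polynomial.X : Polynomial A)) (powers_X_le_nonZeroDivisors A)

instance isIntegrallyClosedIn_laurentPolynomial [IsDomain A] [IsIntegrallyClosed A] :
    IsIntegrallyClosedIn (Polynomial A) A[T;T⁻¹] :=
  isIntegrallyClosedIn_of_isLocalization _ (powers_X_le_nonZeroDivisors A)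

variable {A} in
lemma coeff_toLaurent_of_neg (p : Polynomial A) {i : ℤ} (hi : i < 0) :
    (Polynomial.toLaurent p).coeff i = 0 := by
  rw [LaurentPolynomial.coeff_toLaurent]
  refine Finsupp.mapDomain_of_notMem_range _ _ ?_
  rintro ⟨n, rfl⟩
  exact absurd hi (by simp)

lemma isIntegrallyClosed_addMonoidAlgebra_fin [IsDomain A] [IsIntegrallyClosed A] (n : ℕ) :
    IsIntegrallyClosed (AddMonoidAlgebra A (Fin n → ℤ)) := by
  induction n with
  | zero => exact .of_equiv (AddMonoidAlgebra.uniqueRingEquiv (R := A) (Fin 0 → ℤ)).symm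
  | succ n ih =>
    let e : (Fin (n + 1) → ℤ) ≃+ ℤ × (Fin n → ℤ) :=
      (Fin.consLinearEquiv ℤ fun _ : Fin (n + 1) => ℤ).symm.toAddEquiv
    exact .of_equiv ((AddMonoidAlgebra.mapDomainRingEquiv A e).trans
      (AddMonoidAlgebra.curryRingEquiv : _ ≃+* (AddMonoidAlgebra A (Fin n → ℤ))[T;T⁻¹])).symm

variable (M : Type*) [AddCommGroup M]

instance isDomain_addMonoidAlgebra [IsDomain A] [Module.Free ℤ M] [Module.Finite ℤ M] :
    IsDomain (AddMonoidAlgebra A M) :=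
  (AddMonoidAlgebra.mapDomainRingEquiv A
    (Module.finBasis ℤ M).equivFun.toAddEquiv).toMulEquiv.isDomain _

instance isIntegrallyClosed_addMonoidAlgebra [IsDomain A] [IsIntegrallyClosed A]
    [Module.Free ℤ M] [Module.Finite ℤ M] : IsIntegrallyClosed (AddMonoidAlgebra A M) := by
  have := isIntegrallyClosed_addMonoidAlgebra_fin A (Module.finrank ℤ M)
  exact .of_equiv
    (AddMonoidAlgebra.mapDomainRingEquiv A (Module.finBasis ℤ M).equivFun.toAddEquiv).symm

variable {M}

/-- The coaction `x^m ↦ x^m T^{⟨m, n⟩}` of the one-parameter subgroup `n`. -/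
def coaction (n : M →ₗ[ℤ] ℤ) : AddMonoidAlgebra A M →+* (AddMonoidAlgebra A M)[T;T⁻¹] :=
  AddMonoidAlgebra.curryRingEquiv.toRingHom.comp
    (AddMonoidAlgebra.mapDomainRingHom A (n.toAddMonoidHom.prod (AddMonoidHom.id M)))

variable {A}

lemma coaction_single (n : M →ₗ[ℤ] ℤ) (m : M) (a : A) :
    coaction A n (AddMonoidAlgebra.single m a) =
      AddMonoidAlgebra.single (n m) (AddMonoidAlgebra.single m a) := by
  simp [coaction]

lemma coeff_coaction (n : M →ₗ[ℤ] ℤ) (x : AddMonoidAlgebra A M) (m : M) :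
    ((coaction A n x).coeff (n m)).coeff m = x.coeff m := by
  have hinj : Function.Injective fun m => (n m, m) := fun _ _ h => congrArg Prod.snd h
  exact Finsupp.mapDomain_apply hinj x.coeff m

variable {S : AddSubmonoid M}

lemma exists_toLaurent_comp_eq_coaction_comp {n : M →ₗ[ℤ] ℤ} (hn : ∀ m ∈ S, 0 ≤ n m) :
    ∃ ψ : AddMonoidAlgebra A S →+* Polynomial (AddMonoidAlgebra A M),
      Polynomial.toLaurent.comp ψ =
        (coaction A n).comp (AddMonoidAlgebra.mapDomainRingHom A S.subtype) := by
  let deg : S →+ ℕ × M :=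
    { toFun m := ((n m).toNat, m)
      map_zero' := by simp
      map_add' a b := by simp [Int.toNat_add (hn a a.2) (hn b b.2)] }
  refine ⟨(Polynomial.toFinsuppIso _).symm.toRingHom.comp
    (AddMonoidAlgebra.curryRingEquiv.toRingHom.comp
      (AddMonoidAlgebra.mapDomainRingHom A deg)), AddMonoidAlgebra.ringHom_ext ?_ ?_⟩
  · intro a
    simp [Polynomial.toLaurent_apply, coaction_single, deg]
  · intro m
    simp [Polynomial.toLaurent_apply, coaction_single, deg, hn m m.2]

-- `x` integral over `A[S]` makes its coaction integral over the polynomials, hence a polynomial.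
lemma apply_nonneg_of_isIntegralElem [IsDomain (AddMonoidAlgebra A M)]
    [IsIntegrallyClosed (AddMonoidAlgebra A M)] {n : M →ₗ[ℤ] ℤ} (hn : ∀ m ∈ S, 0 ≤ n m)
    {x : AddMonoidAlgebra A M}
    (hx : (AddMonoidAlgebra.mapDomainRingHom A S.subtype).IsIntegralElem x) {m : M}
    (hm : x.coeff m ≠ 0) : 0 ≤ n m := by
  obtain ⟨ψ, hψ⟩ := exists_toLaurent_comp_eq_coaction_comp (A := A) hn
  have hint : IsIntegral (Polynomial (AddMonoidAlgebra A M)) (coaction A n x) :=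
    RingHom.IsIntegralElem.of_comp (f := ψ) (hψ ▸ hx.map (coaction A n))
  obtain ⟨q, hq⟩ := IsIntegrallyClosedIn.algebraMap_eq_of_integral hint
  rw [LaurentPolynomial.algebraMap_eq_toLaurent] at hq
  by_contra! hneg
  refine hm ?_
  rw [← coeff_coaction n, ← hq, coeff_toLaurent_of_neg q hneg]
  rfl

lemma mem_range_mapDomainRingHom_subtype {x : AddMonoidAlgebra A M}
    (hx : ∀ m, x.coeff m ≠ 0 → m ∈ S) :
    x ∈ (AddMonoidAlgebra.mapDomainRingHom A S.subtype).range := by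
  rw [← AddMonoidAlgebra.sum_coeff_single x]
  refine sum_mem fun m hm => ?_
  exact ⟨AddMonoidAlgebra.single ⟨m, hx m (Finsupp.mem_support_iff.1 hm)⟩ (x.coeff m), by simp⟩

theorem isIntegrallyClosed_addMonoidAlgebra_of_mem_iff [IsDomain A] [IsIntegrallyClosed A]
    [Module.Free ℤ M] [Module.Finite ℤ M] {N : Set (M →ₗ[ℤ] ℤ)}
    (hS : ∀ m, m ∈ S ↔ ∀ n ∈ N, 0 ≤ n m) : IsIntegrallyClosed (AddMonoidAlgebra A S) := by
  let := (AddMonoidAlgebra.mapDomainRingHom A S.subtype).toAlgebra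
  have hinj : Function.Injective
      (algebraMap (AddMonoidAlgebra A S) (AddMonoidAlgebra A M)) :=
    AddMonoidAlgebra.mapDomain_injective Subtype.val_injective
  have := (faithfulSMul_iff_algebraMap_injective _ _).2 hinj
  have : IsIntegrallyClosedIn (AddMonoidAlgebra A S) (AddMonoidAlgebra A M) := by
    refine isIntegrallyClosedIn_iff.2 ⟨hinj, fun {x} hx => ?_⟩
    exact mem_range_mapDomainRingHom_subtype fun m hm => (hS m).2 fun n hn =>
      apply_nonneg_of_isIntegralElem (fun m hm => (hS m).1 hm n hn) hx hm
  exact .of_isIntegrallyClosed_of_isIntegrallyClosedIn _ (AddMonoidAlgebra A M)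

theorem isIntegrallyClosed_coordRing (k : Type u) [Field k] {M : Type u} [AddCommGroup M]
    [Module.Free ℤ M] [Module.Finite ℤ M] {σ : PointedCone ℝ (M →ₗ[ℤ] ℝ)}
    (hσ : IsRationalPolyhedral σ) : IsIntegrallyClosed (CoordRing k σ) := by
  obtain ⟨S, rfl⟩ := hσ
  exact isIntegrallyClosed_addMonoidAlgebra_of_mem_iff (N := S) fun _ => mem_dualMonoid_hull

end MonoidAlgebra

section OpenImmersion

lemma isIntegrallyClosed_stalk_spec (R : CommRingCat.{u}) [IsDomain R] [IsIntegrallyClosed R]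
    (y : Spec R) : IsIntegrallyClosed ((Spec R).presheaf.stalk y) := by
  let : Algebra R ((Spec R).presheaf.stalk y) := StructureSheaf.stalkAlgebra R y
  have : IsLocalization.AtPrime ((Spec R).presheaf.stalk y)
      (show PrimeSpectrum R from y).asIdeal := StructureSheaf.IsLocalization.to_stalk R y
  exact isIntegrallyClosed_of_isLocalization (R := R) _
    (show PrimeSpectrum R from y).asIdeal.primeCompl (Ideal.primeCompl_le_nonZeroDivisors _)

lemma isIntegrallyClosed_stalk_of_isOpenImmersion {X Y : Scheme.{u}} (f : X ⟶ Y) [IsOpenImmersion f]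
    (x : X) [IsIntegrallyClosed (X.presheaf.stalk x)] :
    IsIntegrallyClosed (Y.presheaf.stalk (f x)) :=
  IsIntegrallyClosed.of_equiv (asIso (f.stalkMap x)).commRingCatIsoToRingEquiv.symm

lemma map_appIso_inv {A B X : Scheme.{u}} (f : A ⟶ B) (g : B ⟶ X) [IsOpenImmersion g] {h : A ⟶ X}
    [IsOpenImmersion h] (w : f ≫ g = h) (hle : h ''ᵁ ⊤ ≤ g ''ᵁ ⊤) (s : Γ(B, ⊤)) :
    X.presheaf.map (homOfLE hle).op ((g.appIso ⊤).inv s) = (h.appIso ⊤).inv (f.appTop s) := by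
  subst w
  have e : (⊤ : A.Opens) ≤ (f ≫ g) ⁻¹ᵁ (g ''ᵁ ⊤) := by
    rw [Scheme.Hom.comp_preimage, Scheme.Hom.preimage_image_eq]; exact le_top
  have h_restrict := Scheme.Hom.appLE_appIso_inv (f ≫ g) e
  have h_pullback : (g.appIso ⊤).inv ≫ (f ≫ g).appLE (g ''ᵁ ⊤) ⊤ e = f.appTop := by
    rw [Scheme.Hom.comp_appLE, Scheme.Hom.appIso_inv_app_assoc]
    exact (Scheme.Hom.map_appLE f _ _).trans (Scheme.Hom.appLE_eq_app f)
  rw [← h_pullback, ← ConcreteCategory.comp_apply, ← ConcreteCategory.comp_apply, Category.assoc,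
    h_restrict]

end OpenImmersion

variable {M : Type u} [AddCommGroup M]

section Ray

lemma exists_eq_smul_toReal_of_mem_rayCone {n : M →ₗ[ℤ] ℤ} {v : M →ₗ[ℤ] ℝ} (hv : v ∈ rayCone n)
    (hv0 : v ≠ 0) : ∃ c : ℝ, 0 < c ∧ v = c • toReal n := by
  obtain ⟨c, rfl⟩ := Submodule.mem_span_singleton.1 hv
  refine ⟨c, lt_of_le_of_ne' c.2 fun h => hv0 ?_, rfl⟩
  rw [show c = 0 from Subtype.ext h, zero_smul]

lemma eq_of_mem_rayCone {n n' : M →ₗ[ℤ] ℤ} (hn : IsPrimitive n) (hn' : IsPrimitive n')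
    {v : M →ₗ[ℤ] ℝ} (hv0 : v ≠ 0) (hv : v ∈ rayCone n) (hv' : v ∈ rayCone n') : n = n' := by
  obtain ⟨c, hc, rfl⟩ := exists_eq_smul_toReal_of_mem_rayCone hv hv0
  obtain ⟨c', hc', h⟩ := exists_eq_smul_toReal_of_mem_rayCone hv' hv0
  have h_apply (l : M) : c * n l = c' * n' l := LinearMap.congr_fun h l
  obtain ⟨m, hm⟩ := hn.exists_apply_eq_one
  have hc_eq : c = c' * n' m := by simpa [hm] using h_apply m
  have hn'_eq : n' = n' m • n := by
    ext l
    have := h_apply l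
    rw [hc_eq, mul_assoc] at this
    exact_mod_cast (mul_left_cancel₀ hc'.ne' this).symm
  have hpos : 0 < n' m := by exact_mod_cast pos_of_mul_pos_right (hc_eq ▸ hc) hc'.le
  rw [hn'_eq, Int.eq_one_of_dvd_one hpos.le (hn' _ _ hn'_eq).dvd, one_smul]

lemma IsPrimitive.toReal_ne_zero {n : M →ₗ[ℤ] ℤ} (hn : IsPrimitive n) : toReal n ≠ 0 := by
  obtain ⟨m, hm⟩ := hn.exists_apply_eq_one
  intro h
  simpa [hm] using LinearMap.congr_fun h m

instance finite_ray (Δ : Fan M) : Finite Δ.Ray := by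
  have := Δ.finite.to_subtype
  refine Finite.of_injective (Fan.Ray.cone (Δ := Δ)) fun ρ ρ' h => Subtype.ext ?_
  have hmem : toReal ρ.1 ∈ rayCone ρ.1 := Submodule.subset_span rfl
  have hcone : rayCone ρ.1 = rayCone ρ'.1 := congrArg Subtype.val h
  exact eq_of_mem_rayCone ρ.2.1 ρ'.2.1 ρ.2.1.toReal_ne_zero hmem (hcone ▸ hmem)

end Ray

section Toric
variable (k : Type u) [Field k] (Δ : Fan M)

instance compactSpace_toricVariety : CompactSpace (toricVariety k Δ) := by
  have := Δ.finite.to_subtype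
  have hcover : (⋃ σ, Set.range (chart k Δ σ)) = Set.univ :=
    Set.eq_univ_of_forall fun x => Set.mem_iUnion.2 (exists_chart k Δ x)
  exact ⟨hcover ▸ isCompact_iUnion fun σ => isCompact_range (chart k Δ σ).continuous⟩

lemma isUnit_chi {σ : PointedCone ℝ (M →ₗ[ℤ] ℝ)} (m : dualMonoid σ)
    (hm : -(m : M) ∈ dualMonoid σ) : IsUnit (chi k σ m) := by
  refine IsUnit.of_mul_eq_one (chi k σ ⟨_, hm⟩) ?_
  rw [chi_mul, AddMonoidAlgebra.one_def]
  congr 1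
  exact Subtype.ext (add_neg_cancel _)

/-- The elements of the coordinate ring of `U_σ` as sections over `U_σ` of the structure sheaf. -/
def chartSection (σ : Δ.cones) : CoordRing k σ.1 →+*
    Γ(toricVariety k Δ, chart k Δ σ ''ᵁ ⊤) :=
  ((Scheme.ΓSpecIso (.of (CoordRing k σ.1))).inv ≫ ((chart k Δ σ).appIso ⊤).inv).hom

lemma image_chart_le {σ τ : Δ.cones} (h : τ.1 ≤ σ.1) :
    chart k Δ τ ''ᵁ ⊤ ≤ chart k Δ σ ''ᵁ ⊤ := by
  rintro _ ⟨y, -, rfl⟩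
  exact ⟨chartMap k h y, trivial, (Scheme.Hom.comp_apply _ _ y).symm.trans
    (congrArg (fun f : affineChart k τ.1 ⟶ _ => f y) (chartMap_chart k Δ h))⟩

lemma map_chartSection {σ τ : Δ.cones} (h : τ.1 ≤ σ.1) (r : CoordRing k σ.1) :
    (toricVariety k Δ).presheaf.map (homOfLE (image_chart_le k Δ h)).op (chartSection k Δ σ r) =
      chartSection k Δ τ (coordMap k h r) := by
  refine (map_appIso_inv (chartMap k h) (chart k Δ σ) (chartMap_chart k Δ h)
    (image_chart_le k Δ h) _).trans ?_
  exact congrArg ((chart k Δ τ).appIso ⊤).inv (ConcreteCategory.congr_hom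
    (Scheme.ΓSpecIso_inv_naturality (CommRingCat.ofHom (coordMap k h))) r).symm

variable [Module.Free ℤ M] [Module.Finite ℤ M]

instance isIntegrallyClosed_stalk_toricVariety (x : toricVariety k Δ) :
    IsIntegrallyClosed ((toricVariety k Δ).presheaf.stalk x) := by
  obtain ⟨σ, y, rfl⟩ := exists_chart k Δ x
  have : IsIntegrallyClosed (CoordRing k σ.1) := isIntegrallyClosed_coordRing k (Δ.rational _ σ.2)
  have := isIntegrallyClosed_stalk_spec (.of (CoordRing k σ.1)) y
  exact isIntegrallyClosed_stalk_of_isOpenImmersion (chart k Δ σ) y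

variable {Δ}

lemma exists_ne_zero_mem_of_chartMap_eq_orbitPoint {n : M →ₗ[ℤ] ℤ} (hn : IsPrimitive n)
    {τ : PointedCone ℝ (M →ₗ[ℤ] ℝ)} (h : τ ≤ rayCone n) {z : affineChart k τ}
    (hz : chartMap k h z = orbitPoint k n) : ∃ v ∈ τ, v ≠ 0 := by
  by_contra! hτ
  obtain ⟨m, hm⟩ := hn.exists_apply_eq_one
  have hmn : m ∈ dualMonoid (rayCone n) := mem_dualMonoid_rayCone.2 (by lia)
  have h_mem : chi k (rayCone n) ⟨m, hmn⟩ ∈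
      (show PrimeSpectrum (CoordRing k (rayCone n)) from chartMap k h z).asIdeal := by
    rw [hz]
    exact Ideal.subset_span ⟨⟨m, hmn⟩, hm.ge.trans_lt' zero_lt_one, rfl⟩
  have h_mem_z : coordMap k h (chi k (rayCone n) ⟨m, hmn⟩) ∈
    (show PrimeSpectrum (CoordRing k τ) from z).asIdeal := h_mem
  rw [coordMap_single] at h_mem_z
  refine (show PrimeSpectrum (CoordRing k τ) from z).2.ne_top
    (Ideal.eq_top_of_isUnit_mem _ h_mem_z ?_)
  exact isUnit_chi k ⟨m, dualMonoid_anti h hmn⟩ fun v hv => by rw [hτ v hv]; exact le_rfl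

lemma rayDivisor_injective : Function.Injective (rayDivisor k (Δ := Δ)) := by
  intro ρ ρ' h
  have h_chart : chart k Δ ρ.cone (orbitPoint k ρ.1) = chart k Δ ρ'.cone (orbitPoint k ρ'.1) :=
    congrArg Subtype.val h
  obtain ⟨τ, f, f', z, hz, -⟩ := (Scheme.IsLocallyDirected.ι_eq_ι_iff (chartFunctor k Δ)).1 h_chart
  obtain ⟨v, hv, hv0⟩ := exists_ne_zero_mem_of_chartMap_eq_orbitPoint k ρ.2.1 (leOfHom f) hz
  exact Subtype.ext (eq_of_mem_rayCone ρ.2.1 ρ'.2.1 hv0 (leOfHom f hv) (leOfHom f' hv))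

lemma exists_algebraMap_eq_monomial (ρ : Δ.Ray) {m : M} (hm : 0 ≤ ρ.1 m) :
    ∃ a : (toricVariety k Δ).presheaf.stalk (rayDivisor k ρ).1,
      algebraMap _ (toricVariety k Δ).functionField a = monomial k Δ m := by
  have hmρ : m ∈ dualMonoid ρ.cone.1 := mem_dualMonoid_rayCone.2 hm
  have h0 : Δ.zeroCone.1 ≤ ρ.cone.1 := bot_le
  let s := chartSection k Δ ρ.cone (chi k _ ⟨m, hmρ⟩)
  have hs : (toricVariety k Δ).presheaf.map (homOfLE (image_chart_le k Δ h0)).op s =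
      chartSection k Δ Δ.zeroCone (chi k _ ⟨m, dualMonoid_anti h0 hmρ⟩) := by
    rw [map_chartSection k Δ h0, coordMap_single]
  have hD : (rayDivisor k ρ).1 ∈ chart k Δ ρ.cone ''ᵁ ⊤ := ⟨orbitPoint k ρ.1, trivial, rfl⟩
  refine ⟨(toricVariety k Δ).presheaf.germ _ _ hD s, ?_⟩
  rw [← germAt_eq_algebraMap ⟨_, hD⟩ hD, monomial]
  exact (TopCat.Presheaf.germ_res_apply (toricVariety k Δ).presheaf
    (homOfLE (image_chart_le k Δ h0)) _ _ s).symm.trans (congrArg _ hs)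

theorem exists_isJumpDecoration_rayDivisor_monomial {m : Δ.Ray → M}
    (hm : ∀ ρ : Δ.Ray, 0 ≤ ρ.1 (m ρ)) :
    ∃ W, IsJumpDecoration W (rayDivisor k (Δ := Δ))
        (fun ρ => value (rayDivisor k ρ) (monomial k Δ (m ρ))) ∧
      W.IsWeilDecoration ∧ IsReflexive W.sheaf ∧ rank W.sheaf = 2 := by
  choose a ha using fun ρ : Δ.Ray => exists_algebraMap_eq_monomial k ρ (hm ρ)
  simp only [← ha, value_algebraMap]
  exact exists_isJumpDecoration (rayDivisor_injective k) _

end Toric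

end

end WeilDeco

theorem theoremC_general (k : Type u) [Field k] {M : Type u} [AddCommGroup M] [Module.Free ℤ M]
    [Module.Finite ℤ M] (Δ : WeilDeco.Fan M) :
    (∀ h : ∀ ρ : Δ.Ray, (WeilDeco.toricVariety k Δ).residueField (WeilDeco.rayDivisor k ρ).1,
      ∃ W, WeilDeco.IsJumpDecoration W (WeilDeco.rayDivisor k) (fun ρ => h ρ) ∧
        W.IsWeilDecoration ∧ WeilDeco.IsReflexive W.sheaf ∧ WeilDeco.rank W.sheaf = 2) ∧
    ∀ u : (Δ.Ray →₀ ℤ) →ₗ[ℤ] M, (∀ ρ : Δ.Ray, 0 ≤ ρ.1 (u (Finsupp.single ρ 1))) →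
      ∃ W, WeilDeco.IsJumpDecoration W (WeilDeco.rayDivisor k)
          (fun ρ => WeilDeco.value (WeilDeco.rayDivisor k ρ)
            (WeilDeco.monomial k Δ (u (Finsupp.single ρ 1)))) ∧
        W.IsWeilDecoration ∧ WeilDeco.IsReflexive W.sheaf ∧ WeilDeco.rank W.sheaf = 2 :=
  ⟨WeilDeco.exists_isJumpDecoration (WeilDeco.rayDivisor_injective k),
    fun _ hu => WeilDeco.exists_isJumpDecoration_rayDivisor_monomial k hu⟩

theorem theoremC (k : Type u) [Field k] [IsAlgClosed k] [CharZero k]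
    {M : Type u} [AddCommGroup M] [Module.Free ℤ M] [Module.Finite ℤ M] (Δ : WeilDeco.Fan M) :
    let X := WeilDeco.toricVariety k Δ
    let K := X.functionField
    (∀ h : ∀ ρ : Δ.Ray, (X.residueField (WeilDeco.rayDivisor k ρ).1)ˣ,
      ∃ W : WeilDeco.PreWeilDecoration X (K × K),
        (∀ (f g : K) (P : WeilDeco.PrimeDivisor X),
          ((∃ ρ : Δ.Ray, P = WeilDeco.rayDivisor k ρ ∧ g ≠ 0 ∧
              WeilDeco.value (WeilDeco.rayDivisor k ρ) (f / g) =
                (h ρ : X.residueField (WeilDeco.rayDivisor k ρ).1)) →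
            WeilDeco.coeff (W.toFun (f, g)) P =
              min (WeilDeco.ordTop P f) (WeilDeco.ordTop P g) + 1) ∧
          ((¬ ∃ ρ : Δ.Ray, P = WeilDeco.rayDivisor k ρ ∧ g ≠ 0 ∧
              WeilDeco.value (WeilDeco.rayDivisor k ρ) (f / g) =
                (h ρ : X.residueField (WeilDeco.rayDivisor k ρ).1)) →
            WeilDeco.coeff (W.toFun (f, g)) P =
              min (WeilDeco.ordTop P f) (WeilDeco.ordTop P g))) ∧
        W.IsWeilDecoration ∧ WeilDeco.IsReflexive W.sheaf ∧ WeilDeco.rank W.sheaf = 2) ∧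
    (∀ u : (Δ.Ray →₀ ℤ) →ₗ[ℤ] M, (∀ ρ : Δ.Ray, ρ.1 (u (Finsupp.single ρ 1)) = 0) →
      ∃ W : WeilDeco.PreWeilDecoration X (K × K),
        (∀ (f g : K) (P : WeilDeco.PrimeDivisor X),
          ((∃ ρ : Δ.Ray, P = WeilDeco.rayDivisor k ρ ∧ g ≠ 0 ∧
              WeilDeco.value (WeilDeco.rayDivisor k ρ) (f / g) =
              WeilDeco.value (WeilDeco.rayDivisor k ρ) (WeilDeco.monomial k Δ (u (Finsupp.single ρ 1)))) →
            WeilDeco.coeff (W.toFun (f, g)) P =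
              min (WeilDeco.ordTop P f) (WeilDeco.ordTop P g) + 1) ∧
          ((¬ ∃ ρ : Δ.Ray, P = WeilDeco.rayDivisor k ρ ∧ g ≠ 0 ∧
              WeilDeco.value (WeilDeco.rayDivisor k ρ) (f / g) =
              WeilDeco.value (WeilDeco.rayDivisor k ρ) (WeilDeco.monomial k Δ (u (Finsupp.single ρ 1)))) →
            WeilDeco.coeff (W.toFun (f, g)) P =
              min (WeilDeco.ordTop P f) (WeilDeco.ordTop P g))) ∧
        W.IsWeilDecoration ∧ WeilDeco.IsReflexive W.sheaf ∧ WeilDeco.rank W.sheaf = 2) :=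
  ⟨fun h => (theoremC_general k Δ).1 fun ρ => h ρ,
    fun u hu => (theoremC_general k Δ).2 u fun ρ => (hu ρ).ge⟩
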